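/- Let $\pi$ be a probability measure on a measurable space $\mathsf X$, let $q$ be a Markov kernel on $\mathsf X$, and let $r:\mathsf X^2\to[0,\infty]$ be a measurable version of the Radon--Nikodym derivative $$r(x,y)=\frac{\pi(\mathrm dy)\,q(y,\mathrm dx)}{\pi(\mathrm dx)\,q(x,\mathrm dy)}$$ (the density of the absolutely continuous part of $\pi(\mathrm dy)q(y,\mathrm dx)$ with respect to $\pi(\mathrm dx)q(x,\mathrm dy)$). Let $\mathsf W\subseteq[0,\infty)$ be a Borel set and $Q$ a Markov kernel from $\mathsf X$ to $\mathsf W$ such that $\int w\,Q_x(\mathrm dw)=1$ for all $x\in\mathsf X$. Put $\pi_x(\mathrm dw)=w\,Q_x(\mathrm dw)$ and $\tilde\pi(\mathrm dx,\mathrm dw)=\pi(\mathrm dx)\pi_x(\mathrm dw)$. The marginal kernel on $\mathsf X$ and the pseudo-marginal kernel on $\mathsf X\times\mathsf W$ are $$P(x,\mathrm dy)=\min\{1,r(x,y)\}\,q(x,\mathrm dy)+\rho(x)\,\delta_x(\mathrm dy),$$ $$\tilde P(x,w;\mathrm dy,\mathrm du)=\min\Big\{1,r(x,y)\frac uw\Big\}\,q(x,\mathrm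 dy)\,Q_y(\mathrm du)+\tilde\rho(x,w)\,\delta_{x,w}(\mathrm dy,\mathrm du),$$ where the rejection probabilities $\rho,\tilde\rho$ are such that the total masses are one. For a Markov kernel $\Pi$ with invariant distribution $\mu$ and a function $f$ with $\mu(f^2)<\infty$, the asymptotic variance is $$\mathrm{var}(f,\Pi)=\lim_{n\to\infty}\frac1n\,\mathbb E\bigg(\sum_{k=1}^n\big[f(X_k)-\mu(f)\big]\bigg)^2\in[0,\infty],$$ where $(X_k)_{k\ge0}$ is the Markov chain with kernel $\Pi$ and $X_0\sim\mu$. Let $f:\mathsf X\to\mathbb R$ be measurable with $\pi(f^2)<\infty$, and write $\mathrm{var}(f,\tilde P)$ for $\mathrm{var}(\tilde f,\tilde P)$, where $\tilde f(x,w)=f(x)$. Then the limits defining $\mathrm{var}(f,P)$ and $\mathrm{var}(f,\tilde P)$ exist in $[0,\infty]$, and: (i) $\mathrm{var}(f,\tilde P)\ge\mathrm{var}(f,P)$. (ii) More specifically, $$\mathrm{var}(f,\tilde P)\ge\mathrm{var}(f,P)+\liminf_{\lambda\to1-}\big[\Delta_{\bar P}(g_\lambda)-\Delta_{\tilde P}(g_\lambda)\big],$$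 where, for $\lambda\in[0,1)$, $\phi_\lambda(x)=\sum_{k=0}^\infty\lambda^k\,[P^kf(x)-\pi(f)]$ and $g_\lambda(x,y)=[\phi_\lambda(x)-\phi_\lambda(y)]^2$, and where, for measurable symmetric $g:\mathsf X^2\to[0,\infty)$, $$\Delta_{\bar P}(g)=\int\tilde\pi(\mathrm dx,\mathrm dw)\int q(x,\mathrm dy)\,\pi_y(\mathrm du)\,\min\{1,r(x,y)\}\,g(x,y),$$ $$\Delta_{\tilde P}(g)=\int\tilde\pi(\mathrm dx,\mathrm dw)\int q(x,\mathrm dy)\,Q_y(\mathrm du)\,\min\Big\{1,r(x,y)\frac uw\Big\}\,g(x,y).$$ Here, for $\pi$-almost every $x$, the integrals defining $P^kf(x)$, $k\ge 1$, converge absolutely; and for every $\lambda\in[0,1)$ the series $\phi_\lambda(x)$ converges absolutely for $\pi$-almost every $x$, and $\Delta_{\bar P}(g_\lambda)$ and $\Delta_{\tilde P}(g_\lambda)$ are finite. -/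

import Mathlib

open MeasureTheory ProbabilityTheory Filter Topology
open scoped ENNReal NNReal

noncomputable section

namespace PseudoMarginal

variable {E X : Type*} [MeasurableSpace E] [MeasurableSpace X]

section MarkovChains

/-- The iterates `Kⁿ f` of a kernel acting on a real function: `K⁰ f = f` and
`Kⁿ⁺¹ f (x) = ∫ K(x, dy) Kⁿ f (y)`. -/
def kernelIter (K : Kernel E E) (f : E → ℝ) : ℕ → E → ℝ
  | 0 => f
  | n + 1 => fun x => ∫ y, kernelIter K f n y ∂(K x)

/-- The law on trajectory space `ℕ → E` of the time-homogeneous Markov chain with initial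
distribution `μ` and transition kernel `K` (Ionescu-Tulcea). -/
def chainLaw (μ : Measure E) (K : Kernel E E) [IsMarkovKernel K] : Measure (ℕ → E) :=
  Kernel.trajMeasure (X := fun _ => E) μ
    (fun n => K.comap (fun h : (i : Finset.Iic n) → E => h ⟨n, Finset.mem_Iic.2 le_rfl⟩)
      (measurable_pi_apply _))

/-- `n⁻¹ 𝔼 (∑_{k=1}^n [f(X_k) - μ(f)])²` for the chain `(X_k)` with kernel `K` and `X_0 ∼ μ`,
as an element of `[0, ∞]`. -/
def scaledSumVar (μ : Measure E) (K : Kernel E E) [IsMarkovKernel K] (f : E → ℝ) (n : ℕ) :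
    ℝ≥0∞ :=
  (∫⁻ ω, ENNReal.ofReal ((∑ k ∈ Finset.Icc 1 n, (f (ω k) - ∫ x, f x ∂μ)) ^ 2) ∂(chainLaw μ K)) / n

/-- The asymptotic variance `var(f, K)` exists in `[0, ∞]` and is equal to `v`. -/
def HasAsymptoticVariance (μ : Measure E) (K : Kernel E E) [IsMarkovKernel K] (f : E → ℝ)
    (v : ℝ≥0∞) : Prop :=
  Tendsto (scaledSumVar μ K f) atTop (𝓝 v)

end MarkovChains

section MetropolisHastings

lemma measurable_min_one {r : E → E → ℝ≥0∞} (hr : Measurable (Function.uncurry r)) :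
    Measurable (Function.uncurry fun x y => min 1 (r x y)) :=
  measurable_const.min hr

/-- The Metropolis-Hastings type kernel with proposal `κ` and acceptance ratio `r`:
`min{1, r(x,y)} κ(x, dy) + δ_x(dy) (1 - ∫ min{1, r(x,z)} κ(x, dz))`. -/
def mhKernel (κ : Kernel E E) [IsMarkovKernel κ] (r : E → E → ℝ≥0∞)
    (hr : Measurable (Function.uncurry r)) : Kernel E E where
  toFun x := (κ x).withDensity (fun y => min 1 (r x y)) +
    (1 - ∫⁻ y, min 1 (r x y) ∂(κ x)) • Measure.dirac x
  measurable' := by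
    refine Measure.measurable_of_measurable_coe _ fun s hs => ?_
    have h1 := (measurable_min_one hr).setLIntegral_kernel_prod_right (κ := κ) hs
    have h2 := (measurable_min_one hr).lintegral_kernel_prod_right (κ := κ)
    simp only [Measure.add_apply, Measure.smul_apply, smul_eq_mul, withDensity_apply _ hs,
      Measure.dirac_apply' _ hs]
    exact h1.add ((measurable_const.sub h2).mul (measurable_one.indicator hs))

instance (κ : Kernel E E) [IsMarkovKernel κ] (r : E → E → ℝ≥0∞)
    (hr : Measurable (Function.uncurry r)) : IsMarkovKernel (mhKernel κ r hr) where
  isProbabilityMeasure x := by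
    constructor
    change ((κ x).withDensity (fun y => min 1 (r x y)) +
      (1 - ∫⁻ y, min 1 (r x y) ∂(κ x)) • Measure.dirac x) Set.univ = 1
    simp only [Measure.add_apply, Measure.smul_apply, smul_eq_mul,
      withDensity_apply _ MeasurableSet.univ, Measure.restrict_univ, measure_univ, mul_one]
    refine add_tsub_cancel_of_le ?_
    calc ∫⁻ y, min 1 (r x y) ∂(κ x) ≤ ∫⁻ _, 1 ∂(κ x) := lintegral_mono fun y => min_le_left _ _
      _ = 1 := by simp

/-- `r` is a version of the Radon-Nikodym derivative `π(dy) q(y, dx) / (π(dx) q(x, dy))`: it agrees,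
almost everywhere for `π(dx) q(x, dy)`, with the density of the absolutely continuous part of
`π(dy) q(y, dx)` with respect to `π(dx) q(x, dy)`. -/
def IsMHRatio (π : Measure X) (q : Kernel X X) (r : X → X → ℝ≥0∞) : Prop :=
  Function.uncurry r =ᵐ[π ⊗ₘ q] ((π ⊗ₘ q).map Prod.swap).rnDeriv (π ⊗ₘ q)

end MetropolisHastings

section PseudoMarginalChain

variable {W : Set ℝ≥0}

/-- `π_x(dw) = Q_x(dw) w`. -/
def weightKernel (Q : Kernel X W) [IsMarkovKernel Q] : Kernel X W :=
  Q.withDensity (fun _ w => ((w : ℝ≥0) : ℝ≥0∞))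

/-- `π̃(dx, dw) = π(dx) π_x(dw)`. -/
def pseudoTarget (π : Measure X) (Q : Kernel X W) [IsMarkovKernel Q] : Measure (X × W) :=
  π ⊗ₘ weightKernel Q

/-- The proposal `q̃(x, w; dy, du) = q(x, dy) Q_y(du)`. -/
def pseudoProposal (q : Kernel X X) (Q : Kernel X W) : Kernel (X × W) (X × W) :=
  Kernel.prodMkRight W (q ⊗ₖ Kernel.prodMkLeft X Q)

instance (q : Kernel X X) [IsMarkovKernel q] (Q : Kernel X W) [IsMarkovKernel Q] :
    IsMarkovKernel (pseudoProposal q Q) := by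
  unfold pseudoProposal; infer_instance

/-- The acceptance ratio `r(x, y) u / w`. -/
def pseudoRatio (r : X → X → ℝ≥0∞) (z z' : X × W) : ℝ≥0∞ :=
  r z.1 z'.1 * (((z'.2 : ℝ≥0) : ℝ≥0∞) / ((z.2 : ℝ≥0) : ℝ≥0∞))

lemma measurable_pseudoRatio {r : X → X → ℝ≥0∞} (hr : Measurable (Function.uncurry r)) :
    Measurable (Function.uncurry (pseudoRatio (W := W) r)) := by
  have h1 : Measurable fun p : (X × W) × (X × W) => r p.1.1 p.2.1 :=
    hr.comp ((measurable_fst.comp measurable_fst).prodMk (measurable_fst.comp measurable_snd))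
  have h2 : Measurable fun p : (X × W) × (X × W) => ((p.2.2 : ℝ≥0) : ℝ≥0∞) := by fun_prop
  have h3 : Measurable fun p : (X × W) × (X × W) => ((p.1.2 : ℝ≥0) : ℝ≥0∞) := by fun_prop
  exact h1.mul (h2.div h3)

/-- The pseudo-marginal kernel
`P̃(x,w; dy,du) = min{1, r(x,y) u/w} q(x,dy) Q_y(du) + δ_{x,w}(dy,du) ρ̃(x,w)`. -/
def pseudoKernel (q : Kernel X X) [IsMarkovKernel q] (Q : Kernel X W) [IsMarkovKernel Q]
    (r : X → X → ℝ≥0∞) (hr : Measurable (Function.uncurry r)) : Kernel (X × W) (X × W) :=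
  mhKernel (pseudoProposal q Q) (pseudoRatio r) (measurable_pseudoRatio hr)

instance (q : Kernel X X) [IsMarkovKernel q] (Q : Kernel X W) [IsMarkovKernel Q]
    (r : X → X → ℝ≥0∞) (hr : Measurable (Function.uncurry r)) :
    IsMarkovKernel (pseudoKernel q Q r hr) := by
  unfold pseudoKernel; infer_instance

/-- `Δ_P̄(g) = ∫ π̃(dx,dw) ∫ q(x,dy) π_y(du) min{1, r(x,y)} g(x,y)`. -/
def deltaBar (π : Measure X) (q : Kernel X X) (Q : Kernel X W) [IsMarkovKernel Q]
    (r : X → X → ℝ≥0∞) (g : X → X → ℝ≥0∞) : ℝ≥0∞ :=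
  ∫⁻ z, ∫⁻ y, ∫⁻ _u, min 1 (r z.1 y) * g z.1 y ∂(weightKernel Q y) ∂(q z.1) ∂(pseudoTarget π Q)

/-- `Δ_P̃(g) = ∫ π̃(dx,dw) ∫ q(x,dy) Q_y(du) min{1, r(x,y) u/w} g(x,y)`. -/
def deltaTilde (π : Measure X) (q : Kernel X X) (Q : Kernel X W) [IsMarkovKernel Q]
    (r : X → X → ℝ≥0∞) (g : X → X → ℝ≥0∞) : ℝ≥0∞ :=
  ∫⁻ z, ∫⁻ y, ∫⁻ u, min 1 (pseudoRatio r z (y, u)) * g z.1 y ∂(Q y) ∂(q z.1) ∂(pseudoTarget π Q)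

/-- `φ_t(x) = ∑_{k ≥ 0} t^k [P^k f(x) - π(f)]`. -/
def phi (π : Measure X) (P : Kernel X X) (f : X → ℝ) (t : ℝ) (x : X) : ℝ :=
  ∑' k : ℕ, t ^ k * (kernelIter P f k x - ∫ y, f y ∂π)

/-- `g_t(x, y) = [φ_t(x) - φ_t(y)]²`. -/
def gFun (π : Measure X) (P : Kernel X X) (f : X → ℝ) (t : ℝ) (x y : X) : ℝ≥0∞ :=
  ENNReal.ofReal ((phi π P f t x - phi π P f t y) ^ 2)

end PseudoMarginalChain

end PseudoMarginal

end

/-!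
For a reversible kernel `K` with invariant law `μ`, integration against `K` is a symmetric
contraction `T` of `L²(μ)` (`DetailedBalance.isSymmContraction_op`); it is obtained as the adjoint
of the pullback along the first coordinate of `μ(dx) K(x, dy)` composed with the pullback along
the second, so that its properties are read off from the symmetry of that law. With `F = f -
μ(f)`, the scaled variance of a sum of `n` values of the chain is the `n`-th Cesàro mean of the
partial sums of `⟨F, F⟩ + 2 ∑ ⟨F, Tᵏ F⟩` (`scaledSumVar_eq`). No spectral theorem is needed for
the limit: the coefficients of even order are antitone and nonnegative, and the sums of
consecutive pairs `⟨F, T²ʲ F⟩ + ⟨F, T²ʲ⁺¹ F⟩` are nonnegative, which forces the Cesàro and the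
Abel means to have a common limit in `[0, ∞]` (`exists_cesaro_abel_limit`). The Abel mean at `t`
is `2 ⟨F, φ⟩ - ‖F‖²` with `φ = ∑ tᵏ Tᵏ F` the resolvent series, which is the function `φ_t` of the
statement (`DetailedBalance.ae_phi_eq`).

Both kernels are reversible. With respect to a symmetric measure on pairs of states, `π(dx) q(x,
dy)` has a density `a(x, y)`, and then accepted moves have density `min (a(x, y)) (a(y, x))` for
the marginal chain and `min (w a(x, y)) (u a(y, x))`, against `Q_x(dw) Q_y(du)`, for the
pseudo-marginal one (`IsMHRatio.detailedBalance`, `IsMHRatio.detailedBalance_pseudoKernel`).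

Let `S` be the transition operator of the pseudo-marginal chain and `J` the isometric embedding of
`L²(π)` into `L²(π̃)`. Since `⟨JF, (1 - tS)⁻¹ JF⟩` is the supremum over `y` of `2 ⟨JF, y⟩ - ⟨y, (1
- tS) y⟩`, inserting `y = Jφ` bounds the difference of the Abel means below by `2t (⟨Jφ, S Jφ⟩ -
⟨φ, Tφ⟩)` (`IsSymmContraction.inner_resolvent_comparison`). The Dirichlet forms `2 (‖φ‖² - ⟨φ,
Tφ⟩)` and `2 (‖Jφ‖² - ⟨Jφ, S Jφ⟩)` are `Δ_P̄(g_t)` and `Δ_P̃(g_t)` (`lintegral_accept_sq_sub`), so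
the bound is `t (Δ_P̄(g_t) - Δ_P̃(g_t))`. It is nonnegative by Jensen's inequality for the minimum
(`deltaTilde_le_deltaBar`), and letting `t → 1` gives both claims.
-/

noncomputable section

namespace PseudoMarginal

open scoped RealInnerProductSpace

/-! ### Cesàro and Abel means of autocovariance series -/

section Sequences

lemma tendsto_cesaro_atTop {u : ℕ → ℝ} (hu : Tendsto u atTop atTop) :
    Tendsto (fun n : ℕ => (n⁻¹ : ℝ) * ∑ i ∈ Finset.range n, u i) atTop atTop := by
  refine tendsto_atTop.2 fun M => ?_
  -- the means of `min u (M + 1)` converge to `M + 1`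
  have h1 : Tendsto (fun i => min (u i) (M + 1)) atTop (𝓝 (M + 1)) := by
    refine tendsto_const_nhds.congr' ?_
    filter_upwards [hu.eventually_ge_atTop (M + 1)] with i hi using (min_eq_right hi).symm
  filter_upwards [h1.cesaro.eventually_const_le (lt_add_one M)] with n hn
  refine hn.trans ?_
  gcongr
  exact min_le_left _ _

lemma tendsto_cesaro_neg_one_pow :
    Tendsto (fun n : ℕ => (n⁻¹ : ℝ) * ∑ i ∈ Finset.range n, (-1 : ℝ) ^ i) atTop (𝓝 0) := by
  have h : ∀ n : ℕ, ‖(n⁻¹ : ℝ) * ∑ i ∈ Finset.range n, (-1 : ℝ) ^ i‖ ≤ (n⁻¹ : ℝ) := by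
    intro n
    rw [neg_one_geom_sum, norm_mul]
    have h0 : ‖(n⁻¹ : ℝ)‖ = (n⁻¹ : ℝ) := Real.norm_of_nonneg (by positivity)
    rw [h0]
    refine mul_le_of_le_one_right (by positivity) ?_
    split_ifs <;> simp
  exact squeeze_zero_norm h tendsto_inv_atTop_nhds_zero_nat

/-- The partial sums `c₀ + 2 (c₁ + ⋯ + cⱼ)` of the autocovariance series. -/
def covSum (c : ℕ → ℝ) (j : ℕ) : ℝ := 2 * ∑ k ∈ Finset.range (j + 1), c k - c 0

lemma tendsto_of_even_of_odd {u : ℕ → ℝ} {l : ℝ} (h0 : Tendsto (fun n => u (2 * n)) atTop (𝓝 l))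
    (h1 : Tendsto (fun n => u (2 * n + 1)) atTop (𝓝 l)) : Tendsto u atTop (𝓝 l) := by
  rw [tendsto_def] at *
  intro s hs
  obtain ⟨a, ha⟩ := mem_atTop_sets.1 (h0 s hs)
  obtain ⟨b, hb⟩ := mem_atTop_sets.1 (h1 s hs)
  refine mem_atTop_sets.2 ⟨2 * (a + b) + 1, fun n hn => ?_⟩
  rcases Nat.even_or_odd' n with ⟨m, rfl | rfl⟩
  · exact ha m (by omega)
  · exact hb m (by omega)

lemma sum_range_two_mul (c : ℕ → ℝ) (n : ℕ) :
    ∑ k ∈ Finset.range (2 * n), c k = ∑ j ∈ Finset.range n, (c (2 * j) + c (2 * j + 1)) := by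
  induction n with
  | zero => simp
  | succ n ih => rw [Nat.mul_succ, Finset.sum_range_succ, Finset.sum_range_succ, ih,
      Finset.sum_range_succ]; ring

/-- The convergent case: if the pair sums are summable, then the partial sums converge up to an
oscillation of the size of the limit of the even terms, which both averaging methods remove. -/
lemma exists_cesaro_abel_limit_of_summable {c : ℕ → ℝ} (h_anti : Antitone fun j => c (2 * j))
    (h_even : ∀ j, 0 ≤ c (2 * j)) (hs : Summable fun j => c (2 * j) + c (2 * j + 1))
    (h_summable : ∀ t ∈ Set.Ioo (0 : ℝ) 1, Summable fun k => c k * t ^ k) :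
    ∃ v : ℝ, Tendsto (fun n : ℕ => (n⁻¹ : ℝ) * ∑ j ∈ Finset.range n, covSum c j) atTop (𝓝 v) ∧
      Tendsto (fun t : ℝ => 2 * ∑' k, c k * t ^ k - c 0) (𝓝[<] 1) (𝓝 v) := by
  obtain ⟨l, hl⟩ : ∃ l, Tendsto (fun j => c (2 * j)) atTop (𝓝 l) :=
    ⟨_, tendsto_atTop_ciInf h_anti ⟨0, by rintro _ ⟨j, rfl⟩; exact h_even j⟩⟩
  obtain ⟨S, hS⟩ := hs
  -- removing the oscillation makes the full series converge
  set d : ℕ → ℝ := fun k => c k - l * (-1) ^ k with hd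
  have hd_even : ∀ n, ∑ k ∈ Finset.range (2 * n), d k
      = ∑ j ∈ Finset.range n, (c (2 * j) + c (2 * j + 1)) := by
    intro n
    rw [sum_range_two_mul]
    refine Finset.sum_congr rfl fun j _ => ?_
    simp only [hd, pow_succ, pow_mul]
    norm_num
  have h0 : Tendsto (fun n => ∑ k ∈ Finset.range (2 * n), d k) atTop (𝓝 S) := by
    simp_rw [hd_even]; exact hS.tendsto_sum_nat
  have h1 : Tendsto (fun n => ∑ k ∈ Finset.range (2 * n + 1), d k) atTop (𝓝 S) := by
    simp_rw [Finset.sum_range_succ]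
    have h2 : Tendsto (fun n => d (2 * n)) atTop (𝓝 0) := by
      have := hl.sub_const l
      simpa [hd, pow_mul] using this
    simpa using h0.add h2
  have hdS := tendsto_of_even_of_odd (u := fun n => ∑ k ∈ Finset.range n, d k) h0 h1
  have h_ev : ∀ᶠ t : ℝ in 𝓝[<] 1, t ∈ Set.Ioo (0 : ℝ) 1 := Ioo_mem_nhdsLT one_pos
  refine ⟨2 * S + l - c 0, ?_, ?_⟩
  · have hD : ∀ j, covSum c j
        = 2 * ∑ k ∈ Finset.range (j + 1), d k + l * (-1) ^ j + (l - c 0) := by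
      intro j
      simp only [covSum, hd, Finset.sum_sub_distrib, ← Finset.mul_sum, neg_one_geom_sum]
      rcases Nat.even_or_odd j with hj | hj
      · rw [if_neg (by simpa [Nat.even_add_one] using hj), hj.neg_one_pow]; ring
      · rw [if_pos hj.add_one, hj.neg_one_pow]; ring
    have h3 : Tendsto (fun j => 2 * ∑ k ∈ Finset.range (j + 1), d k + (l - c 0)) atTop
        (𝓝 (2 * S + (l - c 0))) :=
      (((tendsto_add_atTop_iff_nat 1).2 hdS).const_mul 2).add_const _
    have h4 := h3.cesaro.add (tendsto_cesaro_neg_one_pow.const_mul l)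
    rw [mul_zero, add_zero, ← add_sub_assoc] at h4
    refine h4.congr fun n => ?_
    rw [← mul_assoc, mul_comm l, mul_assoc, ← mul_add, Finset.mul_sum, ← Finset.sum_add_distrib]
    congr 1
    refine Finset.sum_congr rfl fun j _ => ?_
    rw [hD]; ring
  · have h3 := Real.tendsto_tsum_powerSeries_nhdsWithin_lt hdS
    have h4 : Tendsto (fun t : ℝ => l * (1 + t)⁻¹) (𝓝[<] 1) (𝓝 (l * (1 + 1)⁻¹)) := by
      refine Tendsto.mono_left ?_ nhdsWithin_le_nhds
      exact ((tendsto_const_nhds.add tendsto_id).inv₀ (by norm_num)).const_mul l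
    have h5 := ((h3.add h4).const_mul 2).sub_const (c 0)
    rw [show 2 * (S + l * (1 + 1)⁻¹) - c 0 = 2 * S + l - c 0 by ring] at h5
    refine h5.congr' ?_
    filter_upwards [h_ev] with t ht
    have h6 : HasSum (fun k => (-1 : ℝ) ^ k * t ^ k) (1 + t)⁻¹ := by
      have := hasSum_geometric_of_abs_lt_one (r := -t)
        (by rw [abs_neg, abs_of_pos ht.1]; exact ht.2)
      simpa [neg_pow t] using this
    have h7 := ((h_summable t ht).hasSum.sub (h6.mul_left l)).tsum_eq
    have h8 : ∑' k, d k * t ^ k = ∑' k, c k * t ^ k - l * (1 + t)⁻¹ := by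
      rw [← h7]; exact tsum_congr fun k => by simp only [hd]; ring
    rw [h8]; ring

/-- The divergent case: if the pair sums are not summable, both means tend to infinity. -/
lemma tendsto_cesaro_abel_atTop_of_not_summable {c : ℕ → ℝ}
    (h_even : ∀ j, 0 ≤ c (2 * j)) (h_pair : ∀ j, 0 ≤ c (2 * j) + c (2 * j + 1))
    (hs : ¬ Summable fun j => c (2 * j) + c (2 * j + 1))
    (h_summable : ∀ t ∈ Set.Ioo (0 : ℝ) 1, Summable fun k => c k * t ^ k) :
    Tendsto (fun n : ℕ => (n⁻¹ : ℝ) * ∑ j ∈ Finset.range n, covSum c j) atTop atTop ∧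
      Tendsto (fun t : ℝ => 2 * ∑' k, c k * t ^ k - c 0) (𝓝[<] 1) atTop := by
  have hs' := (not_summable_iff_tendsto_nat_atTop_of_nonneg h_pair).1 hs
  have h_ev : ∀ᶠ t : ℝ in 𝓝[<] 1, t ∈ Set.Ioo (0 : ℝ) 1 := Ioo_mem_nhdsLT one_pos
  refine ⟨tendsto_cesaro_atTop ?_, tendsto_atTop.2 fun M => ?_⟩
  · have hdiv : Tendsto (fun n : ℕ => n / 2) atTop atTop :=
      Nat.tendsto_div_const_atTop (by norm_num)
    have h1 : Tendsto (fun n => ∑ k ∈ Finset.range n, c k) atTop atTop := by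
      refine tendsto_atTop_mono (fun n => ?_) (hs'.comp hdiv)
      simp only [Function.comp, ← sum_range_two_mul]
      rcases Nat.even_or_odd' n with ⟨m, rfl | rfl⟩
      · simp
      · rw [show (2 * m + 1) / 2 = m by omega, Finset.sum_range_succ]
        linarith [h_even m]
    have h2 := (tendsto_add_atTop_iff_nat 1).2 h1
    exact tendsto_atTop_add_const_right _ _ (h2.const_mul_atTop two_pos)
  · obtain ⟨N, hN⟩ := (hs'.eventually_gt_atTop ((M + c 0) / 2)).exists
    have h1 : Tendsto (fun t : ℝ => ∑ j ∈ Finset.range N,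
        t ^ (2 * j + 1) * (c (2 * j) + c (2 * j + 1))) (𝓝[<] 1)
        (𝓝 (∑ j ∈ Finset.range N, (1 : ℝ) ^ (2 * j + 1) * (c (2 * j) + c (2 * j + 1)))) := by
      refine Tendsto.mono_left ?_ nhdsWithin_le_nhds
      exact Continuous.tendsto (by fun_prop) 1
    simp only [one_pow, one_mul] at h1
    filter_upwards [h1.eventually_const_lt hN, h_ev] with t ht1 ht
    have hsum := h_summable t ht
    have hE : Summable ((fun k => c k * t ^ k) ∘ fun j => 2 * j) :=
      hsum.comp_injective (mul_right_injective₀ two_ne_zero)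
    have hO : Summable ((fun k => c k * t ^ k) ∘ fun j => 2 * j + 1) :=
      hsum.comp_injective ((add_left_injective 1).comp (mul_right_injective₀ two_ne_zero))
    have h2 : ∀ j, t ^ (2 * j + 1) * (c (2 * j) + c (2 * j + 1))
        ≤ c (2 * j) * t ^ (2 * j) + c (2 * j + 1) * t ^ (2 * j + 1) := by
      intro j
      have h3 : t ^ (2 * j + 1) ≤ t ^ (2 * j) :=
        pow_le_pow_of_le_one ht.1.le ht.2.le (Nat.le_succ _)
      nlinarith [mul_le_mul_of_nonneg_left h3 (h_even j)]
    have h3 : ∑ j ∈ Finset.range N, t ^ (2 * j + 1) * (c (2 * j) + c (2 * j + 1))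
        ≤ ∑' k, c k * t ^ k := by
      have h4 := (hE.hasSum.add hO.hasSum).tsum_eq.trans
        (tsum_even_add_odd (f := fun k => c k * t ^ k) hE hO)
      rw [← h4]
      refine (Finset.sum_le_sum fun j _ => h2 j).trans ((hE.add hO).sum_le_tsum _ fun j _ => ?_)
      exact (mul_nonneg (pow_nonneg ht.1.le _) (h_pair j)).trans (h2 j)
    linarith

/-- A Tauberian statement for autocovariances of a reversible chain: the Cesàro and the Abel means
of the partial sums of the autocovariance series have a common limit in `[0, ∞]`. The even terms are
assumed antitone and nonnegative and the sums of consecutive pairs nonnegative, which is what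
self-adjointness and contractivity of the transition operator provide. -/
lemma exists_cesaro_abel_limit {c : ℕ → ℝ} (h_anti : Antitone fun j => c (2 * j))
    (h_even : ∀ j, 0 ≤ c (2 * j)) (h_pair : ∀ j, 0 ≤ c (2 * j) + c (2 * j + 1))
    (h_summable : ∀ t ∈ Set.Ioo (0 : ℝ) 1, Summable fun k => c k * t ^ k) :
    ∃ v : ℝ≥0∞,
      Tendsto (fun n : ℕ => ENNReal.ofReal ((n⁻¹ : ℝ) * ∑ j ∈ Finset.range n, covSum c j))
        atTop (𝓝 v) ∧
      Tendsto (fun t : ℝ => ENNReal.ofReal (2 * ∑' k, c k * t ^ k - c 0)) (𝓝[<] 1) (𝓝 v) := by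
  by_cases hs : Summable fun j => c (2 * j) + c (2 * j + 1)
  · obtain ⟨v, h1, h2⟩ := exists_cesaro_abel_limit_of_summable h_anti h_even hs h_summable
    exact ⟨ENNReal.ofReal v, ENNReal.tendsto_ofReal h1, ENNReal.tendsto_ofReal h2⟩
  · obtain ⟨h1, h2⟩ := tendsto_cesaro_abel_atTop_of_not_summable h_even h_pair hs h_summable
    exact ⟨∞, ENNReal.tendsto_ofReal_atTop.comp h1, ENNReal.tendsto_ofReal_atTop.comp h2⟩

end Sequences

/-! ### Symmetric contractions of a Hilbert space -/

section Hilbert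

variable {H : Type*} [NormedAddCommGroup H] [InnerProductSpace ℝ H]

/-- A symmetric contraction of a real Hilbert space, as is the transition operator of a reversible
Markov chain on the square integrable functions. -/
structure IsSymmContraction (T : H →L[ℝ] H) : Prop where
  symm : ∀ x y, ⟪T x, y⟫ = ⟪x, T y⟫
  norm_le : ∀ x, ‖T x‖ ≤ ‖x‖

namespace IsSymmContraction

variable {T : H →L[ℝ] H}

lemma inner_pow (hT : IsSymmContraction T) (n : ℕ) (x y : H) :
    ⟪(T ^ n) x, y⟫ = ⟪x, (T ^ n) y⟫ := by
  induction n generalizing x y with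
  | zero => simp
  | succ n ih =>
    have h1 : (T ^ (n + 1)) x = (T ^ n) (T x) := by rw [pow_succ]; rfl
    have h2 : (T ^ (n + 1)) y = T ((T ^ n) y) := by rw [pow_succ']; rfl
    rw [h1, h2, ih, hT.symm]

lemma norm_pow_le (hT : IsSymmContraction T) (n : ℕ) (x : H) : ‖(T ^ n) x‖ ≤ ‖x‖ := by
  induction n with
  | zero => simp
  | succ n ih =>
    have h2 : (T ^ (n + 1)) x = T ((T ^ n) x) := by rw [pow_succ']; rfl
    rw [h2]
    exact (hT.norm_le _).trans ih

lemma inner_pow_two_mul (hT : IsSymmContraction T) (j : ℕ) (x : H) :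
    ⟪x, (T ^ (2 * j)) x⟫ = ‖(T ^ j) x‖ ^ 2 := by
  rw [two_mul, pow_add, ← real_inner_self_eq_norm_sq, hT.inner_pow]
  rfl

lemma inner_pow_two_mul_add_one (hT : IsSymmContraction T) (j : ℕ) (x : H) :
    ⟪x, (T ^ (2 * j + 1)) x⟫ = ⟪(T ^ j) x, T ((T ^ j) x)⟫ := by
  rw [hT.inner_pow, show 2 * j + 1 = j + (j + 1) by ring, pow_add, pow_succ']
  rfl

lemma abs_inner_le (hT : IsSymmContraction T) (x : H) : |⟪x, T x⟫| ≤ ‖x‖ ^ 2 :=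
  (abs_real_inner_le_norm _ _).trans (by
    rw [sq]; exact mul_le_mul_of_nonneg_left (hT.norm_le x) (norm_nonneg x))

lemma summable_inner_pow (hT : IsSymmContraction T) (x y : H) {t : ℝ} (ht : t ∈ Set.Ico (0 : ℝ) 1) :
    Summable fun k => ⟪y, (T ^ k) x⟫ * t ^ k := by
  refine Summable.of_norm_bounded
    ((summable_geometric_of_lt_one ht.1 ht.2).mul_left (‖y‖ * ‖x‖)) fun k => ?_
  rw [norm_mul, norm_pow, Real.norm_of_nonneg ht.1]
  refine mul_le_mul_of_nonneg_right ?_ (pow_nonneg ht.1 _)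
  exact (norm_inner_le_norm _ _).trans
    (mul_le_mul_of_nonneg_left (hT.norm_pow_le _ _) (norm_nonneg _))

/-- The Cesàro means of the autocovariance series of a symmetric contraction converge in `[0, ∞]`,
and so do its Abel means, to the same limit. -/
lemma exists_limit (hT : IsSymmContraction T) (x : H) :
    ∃ v : ℝ≥0∞,
      Tendsto (fun n : ℕ => ENNReal.ofReal
        ((n⁻¹ : ℝ) * ∑ j ∈ Finset.range n, covSum (fun k => ⟪x, (T ^ k) x⟫) j)) atTop (𝓝 v) ∧
      Tendsto (fun t : ℝ => ENNReal.ofReal (2 * ∑' k, ⟪x, (T ^ k) x⟫ * t ^ k - ‖x‖ ^ 2))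
        (𝓝[<] 1) (𝓝 v) := by
  have h := exists_cesaro_abel_limit (c := fun k => ⟪x, (T ^ k) x⟫) ?_ ?_ ?_ ?_
  · simpa [real_inner_self_eq_norm_sq] using h
  · refine antitone_nat_of_succ_le fun j => ?_
    simp only [hT.inner_pow_two_mul]
    have h2 : (T ^ (j + 1)) x = T ((T ^ j) x) := by rw [pow_succ']; rfl
    rw [h2]
    gcongr
    exact hT.norm_le _
  · intro j
    rw [hT.inner_pow_two_mul]
    positivity
  · intro j
    rw [hT.inner_pow_two_mul, hT.inner_pow_two_mul_add_one]
    linarith [neg_le_of_abs_le (hT.abs_inner_le ((T ^ j) x))]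
  · exact fun t ht => hT.summable_inner_pow x x ⟨ht.1.le, ht.2⟩

/-- The resolvent series `∑ tᵏ Tᵏ x`. -/
def resolvent (T : H →L[ℝ] H) (t : ℝ) (x : H) : H := ∑' k : ℕ, t ^ k • (T ^ k) x

lemma summable_norm_resolvent (hT : IsSymmContraction T) (x : H) {t : ℝ}
    (ht : t ∈ Set.Ico (0 : ℝ) 1) : Summable fun k => ‖t ^ k • (T ^ k) x‖ := by
  refine Summable.of_nonneg_of_le (fun _ => norm_nonneg _) (fun k => ?_)
    ((summable_geometric_of_lt_one ht.1 ht.2).mul_right ‖x‖)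
  rw [norm_smul, norm_pow, Real.norm_of_nonneg ht.1]
  exact mul_le_mul_of_nonneg_left (hT.norm_pow_le _ _) (pow_nonneg ht.1 _)

lemma inner_resolvent [CompleteSpace H] (hT : IsSymmContraction T) (x y : H) {t : ℝ}
    (ht : t ∈ Set.Ico (0 : ℝ) 1) :
    ⟪y, resolvent T t x⟫ = ∑' k, ⟪y, (T ^ k) x⟫ * t ^ k := by
  have h := (innerSL ℝ y).map_tsum (hT.summable_norm_resolvent x ht).of_norm
  simp only [innerSL_apply_apply, inner_smul_right] at h
  rw [resolvent, h]
  exact tsum_congr fun k => mul_comm _ _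

lemma resolvent_eq [CompleteSpace H] (hT : IsSymmContraction T) (x : H) {t : ℝ}
    (ht : t ∈ Set.Ico (0 : ℝ) 1) :
    resolvent T t x = x + t • T (resolvent T t x) := by
  have hs := (hT.summable_norm_resolvent x ht).of_norm
  rw [resolvent, T.map_tsum hs, ← tsum_const_smul'' , hs.tsum_eq_zero_add]
  congr 1
  · simp
  · refine tsum_congr fun k => ?_
    rw [map_smul, smul_smul, ← pow_succ', pow_succ' T]
    rfl

variable [CompleteSpace H]

/-- The Abel mean of the autocovariance series of `x` is `‖φ‖² - t² ‖T φ‖²` with `φ` the resolvent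
series. -/
lemma abel_nonneg (hT : IsSymmContraction T) (x : H) {t : ℝ} (ht : t ∈ Set.Ico (0 : ℝ) 1) :
    0 ≤ 2 * ⟪x, resolvent T t x⟫ - ‖x‖ ^ 2 := by
  set φ := resolvent T t x with hφ
  have hx : x = φ - t • T φ := by
    rw [eq_sub_iff_add_eq, hφ]; exact (hT.resolvent_eq x ht).symm
  have h1 : ‖x‖ ^ 2 = ‖φ‖ ^ 2 - 2 * (t * ⟪φ, T φ⟫) + t ^ 2 * ‖T φ‖ ^ 2 := by
    rw [hx, norm_sub_sq_real, inner_smul_right, norm_smul, mul_pow, Real.norm_of_nonneg ht.1]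
  have h2 : ⟪x, φ⟫ = ‖φ‖ ^ 2 - t * ⟪φ, T φ⟫ := by
    conv_lhs => rw [hx]
    rw [inner_sub_left, real_inner_self_eq_norm_sq, inner_smul_left, hT.symm]
    rfl
  have h3 : t ^ 2 * ‖T φ‖ ^ 2 ≤ 1 * ‖φ‖ ^ 2 := by
    gcongr
    · exact pow_le_one₀ ht.1 ht.2.le
    · exact hT.norm_le φ
  rw [h1, h2]
  linarith

/-- Comparison of the resolvents of two symmetric contractions, on a space and on a larger space
containing it isometrically. It expresses that `⟨x, (1 - tS)⁻¹ x⟩` is the supremum over `y` of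
`2 ⟨x, y⟩ - ⟨y, (1 - tS) y⟩`, evaluated at the resolvent series of `T`. -/
lemma inner_resolvent_comparison {G : Type*} [NormedAddCommGroup G] [InnerProductSpace ℝ G]
    [CompleteSpace G] (hT : IsSymmContraction T) {S : G →L[ℝ] G} (hS : IsSymmContraction S)
    (J : H →ₗᵢ[ℝ] G) (x : H) {t : ℝ} (ht : t ∈ Set.Ico (0 : ℝ) 1) :
    ⟪x, resolvent T t x⟫ + t * (⟪J (resolvent T t x), S (J (resolvent T t x))⟫
      - ⟪resolvent T t x, T (resolvent T t x)⟫) ≤ ⟪J x, resolvent S t (J x)⟫ := by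
  set φ := resolvent T t x with hφ
  set ψ := resolvent S t (J x) with hψ
  have hx : x = φ - t • T φ := by
    rw [eq_sub_iff_add_eq, hφ]; exact (hT.resolvent_eq x ht).symm
  have hJx : J x = ψ - t • S ψ := by
    rw [eq_sub_iff_add_eq, hψ]; exact (hS.resolvent_eq (J x) ht).symm
  have h1 : ⟪x, φ⟫ = ‖φ‖ ^ 2 - t * ⟪φ, T φ⟫ := by
    conv_lhs => rw [hx]
    rw [inner_sub_left, real_inner_self_eq_norm_sq, inner_smul_left, hT.symm]
    rfl
  have h2 : ⟪J x, ψ⟫ = ‖ψ‖ ^ 2 - t * ⟪ψ, S ψ⟫ := by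
    conv_lhs => rw [hJx]
    rw [inner_sub_left, real_inner_self_eq_norm_sq, inner_smul_left, hS.symm]
    rfl
  -- `⟨x, φ⟩ = ⟨J x, J φ⟩`, since `J` is isometric
  have h3 : ⟪x, φ⟫ = ⟪ψ, J φ⟫ - t * ⟪ψ, S (J φ)⟫ := by
    rw [← J.inner_map_map, hJx, inner_sub_left, inner_smul_left, hS.symm]
    rfl
  have h4 : ⟪J φ, S ψ⟫ = ⟪ψ, S (J φ)⟫ := by rw [← hS.symm, real_inner_comm]
  -- the quadratic form of `1 - t S` is nonnegative at `ψ - J φ`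
  have h5 := hS.abs_inner_le (ψ - J φ)
  have h6 : t * ⟪ψ - J φ, S (ψ - J φ)⟫ ≤ ‖ψ - J φ‖ ^ 2 := by
    nlinarith [abs_le.1 h5, ht.1, ht.2, sq_nonneg ‖ψ - J φ‖]
  rw [map_sub, inner_sub_left, inner_sub_right, inner_sub_right, h4, norm_sub_sq_real,
    J.norm_map] at h6
  linarith

end IsSymmContraction

end Hilbert

/-! ### The transition operator of a reversible kernel -/

section TransitionOperator

variable {E : Type*} [MeasurableSpace E] {μ : Measure E} [IsProbabilityMeasure μ]
  {K : Kernel E E} [IsMarkovKernel K]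

lemma L2_inner_eq {α : Type*} [MeasurableSpace α] {m : Measure α} (F G : Lp ℝ 2 m) :
    ⟪F, G⟫ = ∫ a, F a * G a ∂m := by
  rw [L2.inner_def]
  exact integral_congr_ae (.of_forall fun a => by simp [mul_comm])

lemma L2_integrable_mul {α : Type*} [MeasurableSpace α] {m : Measure α} (F G : Lp ℝ 2 m) :
    Integrable (fun a => F a * G a) m :=
  (Lp.memLp F).integrable_mul (Lp.memLp G)

/-- Composition with a measure preserving map, as an isometry of `L²` spaces. -/
abbrev pullback {α β : Type*} [MeasurableSpace α] [MeasurableSpace β] {m : Measure α}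
    {m' : Measure β} {g : α → β} (hg : MeasurePreserving g m m') : Lp ℝ 2 m' →ₗᵢ[ℝ] Lp ℝ 2 m :=
  Lp.compMeasurePreservingₗᵢ ℝ g hg

lemma coeFn_pullback {α β : Type*} [MeasurableSpace α] [MeasurableSpace β] {m : Measure α}
    {m' : Measure β} {g : α → β} (hg : MeasurePreserving g m m') (F : Lp ℝ 2 m') :
    pullback hg F =ᵐ[m] fun a => F (g a) :=
  Lp.coeFn_compMeasurePreserving F hg

lemma inner_pullback {α β γ : Type*} [MeasurableSpace α] [MeasurableSpace β] [MeasurableSpace γ]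
    {m : Measure α} {m' : Measure β} {m'' : Measure γ} {g : α → β} {h : α → γ}
    (hg : MeasurePreserving g m m') (hh : MeasurePreserving h m m'') (F : Lp ℝ 2 m')
    (G : Lp ℝ 2 m'') : ⟪pullback hg F, pullback hh G⟫ = ∫ a, F (g a) * G (h a) ∂m := by
  rw [L2_inner_eq]
  refine integral_congr_ae ?_
  filter_upwards [coeFn_pullback hg F, coeFn_pullback hh G] with a h1 h2
  rw [h1, h2]

lemma measurePreserving_fst_compProd : MeasurePreserving Prod.fst (μ ⊗ₘ K) μ :=
  ⟨measurable_fst, Measure.fst_compProd μ K⟩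

/-- Detailed balance: the law `μ(dx) K(x, dy)` of two consecutive states is invariant under exchange
of the two coordinates. -/
abbrev DetailedBalance (μ : Measure E) (K : Kernel E E) : Prop :=
  MeasurePreserving Prod.swap (μ ⊗ₘ K) (μ ⊗ₘ K)

namespace DetailedBalance

lemma measurePreserving_snd (hK : DetailedBalance μ K) : MeasurePreserving Prod.snd (μ ⊗ₘ K) μ :=
  measurePreserving_fst_compProd.comp hK

/-- The transition operator of a reversible kernel on `L²(μ)`, as the conditional expectation of
the second coordinate under `μ(dx) K(x, dy)` given the first: composition with the second
projection followed by the adjoint of composition with the first one. -/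
def op (hK : DetailedBalance μ K) : Lp ℝ 2 μ →L[ℝ] Lp ℝ 2 μ :=
  (ContinuousLinearMap.adjoint
    (pullback (measurePreserving_fst_compProd (K := K))).toContinuousLinearMap) ∘L
    (pullback hK.measurePreserving_snd).toContinuousLinearMap

lemma inner_op (hK : DetailedBalance μ K) (F G : Lp ℝ 2 μ) :
    ⟪F, hK.op G⟫ = ⟪pullback (measurePreserving_fst_compProd (K := K)) F,
      pullback hK.measurePreserving_snd G⟫ := by
  rw [op, ContinuousLinearMap.comp_apply, ContinuousLinearMap.adjoint_inner_right]
  rfl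

lemma isSymmContraction_op (hK : DetailedBalance μ K) : IsSymmContraction hK.op where
  symm F G := by
    rw [real_inner_comm, hK.inner_op, hK.inner_op, inner_pullback, inner_pullback,
      ← hK.integral_comp MeasurableEquiv.prodComm.measurableEmbedding]
    exact integral_congr_ae (.of_forall fun p => mul_comm _ _)
  norm_le F := by
    have h : ‖hK.op F‖ * ‖hK.op F‖ ≤ ‖hK.op F‖ * ‖F‖ := by
      rw [← real_inner_self_eq_norm_mul_norm, hK.inner_op]
      refine (real_inner_le_norm _ _).trans ?_
      rw [LinearIsometry.norm_map, LinearIsometry.norm_map]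
    by_contra! h'
    exact absurd (le_of_mul_le_mul_left h ((norm_nonneg _).trans_lt h')) h'.not_ge

/-- The Dirichlet form of a reversible kernel as the mean square of the increments. -/
lemma lintegral_sq_sub (hK : DetailedBalance μ K) (F : Lp ℝ 2 μ) :
    ∫⁻ p, ENNReal.ofReal ((F p.1 - F p.2) ^ 2) ∂(μ ⊗ₘ K)
      = ENNReal.ofReal (2 * (‖F‖ ^ 2 - ⟪F, hK.op F⟫)) := by
  set A := pullback (measurePreserving_fst_compProd (K := K)) F with hA
  set B := pullback hK.measurePreserving_snd F with hB
  have h1 : ‖A - B‖ ^ 2 = 2 * (‖F‖ ^ 2 - ⟪F, hK.op F⟫) := by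
    rw [norm_sub_sq_real, hK.inner_op, hA, hB, LinearIsometry.norm_map, LinearIsometry.norm_map]
    ring
  rw [← h1, ← real_inner_self_eq_norm_sq, L2_inner_eq,
    ofReal_integral_eq_lintegral_ofReal (L2_integrable_mul _ _)
      (.of_forall fun _ => mul_self_nonneg _)]
  refine lintegral_congr_ae ?_
  filter_upwards [Lp.coeFn_sub A B, coeFn_pullback (measurePreserving_fst_compProd (K := K)) F,
    coeFn_pullback hK.measurePreserving_snd F] with p h2 h3 h4
  rw [h2, Pi.sub_apply, hA, hB, h3, h4, sq]

lemma integrable_comp_snd (hK : DetailedBalance μ K) {h : E → ℝ} (hh : Integrable h μ) :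
    Integrable (fun p : E × E => h p.2) (μ ⊗ₘ K) :=
  hK.measurePreserving_snd.integrable_comp_of_integrable hh

lemma ae_integrable (hK : DetailedBalance μ K) {h : E → ℝ} (hh : Integrable h μ) :
    ∀ᵐ x ∂μ, Integrable h (K x) :=
  ((Measure.integrable_compProd_iff (hK.integrable_comp_snd hh).aestronglyMeasurable).1
    (hK.integrable_comp_snd hh)).1

/-- The transition operator acts by integration against the kernel. -/
lemma coeFn_op (hK : DetailedBalance μ K) (F : Lp ℝ 2 μ) {h : E → ℝ} (hF : F =ᵐ[μ] h) :
    hK.op F =ᵐ[μ] fun x => ∫ y, h y ∂(K x) := by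
  have hh : Integrable h μ := ((Lp.memLp F).integrable one_le_two).congr hF
  have hint := hK.integrable_comp_snd hh
  -- compare integrals over sets `s`, that is, inner products with indicator functions
  refine Integrable.ae_eq_of_forall_setIntegral_eq _ _ ((Lp.memLp _).integrable one_le_two)
    hint.integral_compProd fun s hs hμs => ?_
  rw [← L2.inner_indicatorConstLp_one (𝕜 := ℝ) hs hμs.ne, hK.inner_op, inner_pullback]
  have h1 : ∫ p : E × E, (indicatorConstLp 2 hs hμs.ne (1 : ℝ) : E → ℝ) p.1 * F p.2 ∂(μ ⊗ₘ K)
      = ∫ p in s ×ˢ Set.univ, h p.2 ∂(μ ⊗ₘ K) := by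
    rw [← integral_indicator (hs.prod .univ)]
    refine integral_congr_ae ?_
    have hfst := measurePreserving_fst_compProd (μ := μ) (K := K)
    filter_upwards [hfst.quasiMeasurePreserving.ae_eq_comp
        (indicatorConstLp_coeFn (p := 2) (hs := hs) (hμs := hμs.ne) (c := (1 : ℝ))),
      hK.measurePreserving_snd.quasiMeasurePreserving.ae_eq_comp hF] with p h1 h2
    simp only [Function.comp] at h1 h2
    rw [h1, h2]
    by_cases hp : p.1 ∈ s <;> simp [Set.indicator, hp]
  rw [h1, Measure.setIntegral_compProd hs .univ hint.integrableOn]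
  simp

end DetailedBalance

lemma measurable_kernelIter (K : Kernel E E) {f : E → ℝ} (hf : Measurable f) (k : ℕ) :
    Measurable (kernelIter K f k) := by
  induction k with
  | zero => exact hf
  | succ k ih => exact ih.stronglyMeasurable.integral_kernel.measurable

namespace DetailedBalance

lemma coeFn_op_pow (hK : DetailedBalance μ K) (F : Lp ℝ 2 μ) {f : E → ℝ} (hF : F =ᵐ[μ] f)
    (k : ℕ) : (hK.op ^ k) F =ᵐ[μ] kernelIter K f k := by
  induction k with
  | zero => exact hF
  | succ k ih =>
    have h2 : (hK.op ^ (k + 1)) F = hK.op ((hK.op ^ k) F) := by rw [pow_succ']; rfl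
    rw [h2]
    exact hK.coeFn_op _ ih

lemma integrable_kernelIter (hK : DetailedBalance μ K) {f : E → ℝ} (hf : MemLp f 2 μ) (k : ℕ) :
    Integrable (kernelIter K f k) μ :=
  ((Lp.memLp _).integrable one_le_two).congr (hK.coeFn_op_pow hf.toLp hf.coeFn_toLp k)

lemma ae_kernelIter_sub_const (hK : DetailedBalance μ K) {f : E → ℝ} (hf : MemLp f 2 μ) (c : ℝ)
    (k : ℕ) : kernelIter K (fun x => f x - c) k =ᵐ[μ] fun x => kernelIter K f k x - c := by
  have hconst : ∀ k, kernelIter K (fun _ => c) k = fun _ => c := by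
    intro k
    induction k with
    | zero => rfl
    | succ k ih => funext x; simp [kernelIter, ih]
  have hc : MemLp (fun _ : E => c) 2 μ := memLp_const c
  have h1 := hK.coeFn_op_pow (hf.sub hc).toLp (hf.sub hc).coeFn_toLp k
  have h2 := hK.coeFn_op_pow hf.toLp hf.coeFn_toLp k
  have h3 := hK.coeFn_op_pow hc.toLp hc.coeFn_toLp k
  rw [MemLp.toLp_sub hf hc, map_sub] at h1
  rw [hconst] at h3
  filter_upwards [h1, h2, h3, Lp.coeFn_sub ((hK.op ^ k) hf.toLp) ((hK.op ^ k) hc.toLp)]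
    with x h1 h2 h3 h4
  rw [h4, Pi.sub_apply, h2, h3] at h1
  exact h1.symm

/-- The centered function `f - μ(f)` as an element of `L²(μ)`. -/
def centered (μ : Measure E) [IsProbabilityMeasure μ] {f : E → ℝ} (hf : MemLp f 2 μ) : Lp ℝ 2 μ :=
  (hf.sub (memLp_const (∫ x, f x ∂μ))).toLp

lemma coeFn_centered {f : E → ℝ} (hf : MemLp f 2 μ) :
    centered μ hf =ᵐ[μ] fun x => f x - ∫ x, f x ∂μ :=
  (hf.sub (memLp_const (∫ x, f x ∂μ))).coeFn_toLp

lemma ae_hasSum_phi (hK : DetailedBalance μ K) {f : E → ℝ} (hf : MemLp f 2 μ) {t : ℝ}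
    (ht : t ∈ Set.Ico (0 : ℝ) 1) :
    ∀ᵐ x ∂μ, HasSum (fun k : ℕ => t ^ k * (kernelIter K f k x - ∫ y, f y ∂μ))
      ((IsSymmContraction.resolvent hK.op t (centered μ hf) : Lp ℝ 2 μ) x) := by
  have hs := hK.isSymmContraction_op.summable_norm_resolvent (centered μ hf) ht
  have h1 := Lp.hasSum_coeFn_tsum (f := fun k : ℕ => t ^ k • (hK.op ^ k) (centered μ hf))
    (tsum_enorm_ne_top_iff_summable_norm.2 hs)
  have h2 : ∀ᵐ x ∂μ, ∀ k : ℕ, (t ^ k • (hK.op ^ k) (centered μ hf) : Lp ℝ 2 μ) x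
      = t ^ k * (kernelIter K f k x - ∫ y, f y ∂μ) := by
    refine ae_all_iff.2 fun k => ?_
    filter_upwards [Lp.coeFn_smul (t ^ k) ((hK.op ^ k) (centered μ hf)),
      hK.coeFn_op_pow _ (coeFn_centered hf) k, hK.ae_kernelIter_sub_const hf (∫ y, f y ∂μ) k]
      with x h1 h2 h3
    rw [h1, Pi.smul_apply, h2, h3, smul_eq_mul]
  filter_upwards [h1, h2] with x h1 h2
  simp only [h2] at h1
  exact h1

/-- The pointwise series `φ_t` represents the resolvent series in `L²(μ)`. -/
lemma ae_phi_eq (hK : DetailedBalance μ K) {f : E → ℝ} (hf : MemLp f 2 μ) {t : ℝ}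
    (ht : t ∈ Set.Ico (0 : ℝ) 1) :
    (IsSymmContraction.resolvent hK.op t (centered μ hf) : Lp ℝ 2 μ) =ᵐ[μ] phi μ K f t := by
  filter_upwards [hK.ae_hasSum_phi hf ht] with x hx using hx.tsum_eq.symm

end DetailedBalance

lemma measurable_phi (μ : Measure E) (K : Kernel E E) {f : E → ℝ} (hf : Measurable f) (t : ℝ) :
    Measurable (phi μ K f t) :=
  Measurable.tsum fun k => ((measurable_kernelIter K hf k).sub_const _).const_mul _

end TransitionOperator

/-! ### Second moments of the stationary chain -/

section Chain

variable {E : Type*} [MeasurableSpace E] {μ : Measure E} {K : Kernel E E} [IsMarkovKernel K]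

lemma measurePreserving_eval_zero :
    MeasurePreserving (fun ω : ℕ → E => ω 0) (chainLaw μ K) μ := by
  refine ⟨measurable_pi_apply 0, ?_⟩
  have h1 : (chainLaw μ K).map (Preorder.frestrictLe (π := fun _ => E) 0)
      = μ.map (MeasurableEquiv.piUnique (fun _ : Finset.Iic 0 => E)).symm := by
    rw [chainLaw, Kernel.trajMeasure, Measure.map_comp _ _ (by fun_prop),
      Kernel.traj_map_frestrictLe, Kernel.partialTraj_self, Measure.id_comp]
  have h2 : (fun ω : ℕ → E => ω 0) = (MeasurableEquiv.piUnique (fun _ : Finset.Iic 0 => E)) ∘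
      (Preorder.frestrictLe (π := fun _ => E) 0) := rfl
  rw [h2, ← Measure.map_map (MeasurableEquiv.measurable _) (by fun_prop), h1,
    MeasurableEquiv.map_map_symm]

variable [IsProbabilityMeasure μ]

/-- The transition kernel from histories up to time `n` to the state at time `n + 1`. -/
def historyKernel (K : Kernel E E) (n : ℕ) : Kernel ((_ : Finset.Iic n) → E) E :=
  K.comap (fun h : (i : Finset.Iic n) → E => h ⟨n, Finset.mem_Iic.2 le_rfl⟩)
    (measurable_pi_apply _)

instance (n : ℕ) : IsMarkovKernel (historyKernel K n) := by
  unfold historyKernel; infer_instance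

instance : IsProbabilityMeasure (chainLaw μ K) := by
  unfold chainLaw; infer_instance

/-- The Markov property of the chain. -/
lemma chainLaw_map_history (n : ℕ) :
    (chainLaw μ K).map (Preorder.frestrictLe (π := fun _ => E) n) ⊗ₘ historyKernel K n
      = (chainLaw μ K).map (fun ω => (Preorder.frestrictLe (π := fun _ => E) n ω, ω (n + 1))) :=
  Kernel.map_frestrictLe_trajMeasure_compProd_eq_map_trajMeasure (X := fun _ => E)
    (κ := fun n => historyKernel K n)

lemma measurePreserving_history (n : ℕ) :
    MeasurePreserving (fun ω : ℕ → E => (Preorder.frestrictLe (π := fun _ => E) n ω, ω (n + 1)))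
      (chainLaw μ K)
      ((chainLaw μ K).map (Preorder.frestrictLe (π := fun _ => E) n) ⊗ₘ historyKernel K n) :=
  ⟨by fun_prop, (chainLaw_map_history n).symm⟩

lemma measurePreserving_eval (hK : DetailedBalance μ K) (n : ℕ) :
    MeasurePreserving (fun ω : ℕ → E => ω n) (chainLaw μ K) μ := by
  induction n with
  | zero => exact measurePreserving_eval_zero
  | succ n ih =>
    refine ⟨measurable_pi_apply _, Measure.ext_of_lintegral _ fun g hg => ?_⟩
    have : IsProbabilityMeasure ((chainLaw μ K).map (Preorder.frestrictLe (π := fun _ => E) n)) :=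
      Measure.isProbabilityMeasure_map (by fun_prop)
    rw [lintegral_map hg (measurable_pi_apply _),
      (measurePreserving_history n).lintegral_comp (f := fun p => g p.2) (by fun_prop),
      Measure.lintegral_compProd (by fun_prop), lintegral_map (by fun_prop) (by fun_prop),
      ← hK.measurePreserving_snd.lintegral_comp hg, Measure.lintegral_compProd (by fun_prop),
      ← ih.lintegral_comp (by fun_prop)]
    rfl

/-- One step of the chain acts on second moments through the transition operator. -/
lemma inner_eval_succ (hK : DetailedBalance μ K) (F G : Lp ℝ 2 μ) {j n : ℕ} (hj : j ≤ n) :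
    ⟪pullback (measurePreserving_eval hK j) F, pullback (measurePreserving_eval hK (n + 1)) G⟫
      = ⟪pullback (measurePreserving_eval hK j) F,
          pullback (measurePreserving_eval hK n) (hK.op G)⟫ := by
  have : IsProbabilityMeasure ((chainLaw μ K).map (Preorder.frestrictLe (π := fun _ => E) n)) :=
    Measure.isProbabilityMeasure_map (by fun_prop)
  rw [inner_pullback, inner_pullback]
  let f : E → ℝ := F
  let g : E → ℝ := G
  change ∫ ω, f (ω j) * g (ω (n + 1)) ∂(chainLaw μ K) = ∫ ω, f (ω j) * hK.op G (ω n) ∂(chainLaw μ K)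
  -- the integrand depends on the history up to time `n` and the next state
  have hfm : StronglyMeasurable f := Lp.stronglyMeasurable F
  have hgm : StronglyMeasurable g := Lp.stronglyMeasurable G
  have h1 : Integrable (fun ω : ℕ → E => f (ω j) * g (ω (n + 1))) (chainLaw μ K) := by
    refine (L2_integrable_mul (pullback (measurePreserving_eval hK j) F)
      (pullback (measurePreserving_eval hK (n + 1)) G)).congr ?_
    filter_upwards [coeFn_pullback (measurePreserving_eval hK j) F,
      coeFn_pullback (measurePreserving_eval hK (n + 1)) G] with ω h1 h2
    rw [h1, h2]
  let φ : ((_ : Finset.Iic n) → E) × E → ℝ := fun p => f (p.1 ⟨j, Finset.mem_Iic.2 hj⟩) * g p.2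
  have hφ : StronglyMeasurable φ :=
    (hfm.comp_measurable (by fun_prop)).mul (hgm.comp_measurable measurable_snd)
  have h2 : ∫ ω, f (ω j) * g (ω (n + 1)) ∂(chainLaw μ K) = ∫ p, φ p
      ∂((chainLaw μ K).map (Preorder.frestrictLe (π := fun _ => E) n) ⊗ₘ historyKernel K n) := by
    rw [chainLaw_map_history, integral_map (by fun_prop) hφ.aestronglyMeasurable]
    rfl
  have h3 : Integrable φ
      ((chainLaw μ K).map (Preorder.frestrictLe (π := fun _ => E) n) ⊗ₘ historyKernel K n) := by
    rw [chainLaw_map_history, integrable_map_measure hφ.aestronglyMeasurable (by fun_prop)]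
    exact h1
  rw [h2, Measure.integral_compProd h3, integral_map (by fun_prop)
    (hφ.integral_kernel_prod_right' (κ := historyKernel K n)).aestronglyMeasurable]
  refine integral_congr_ae ?_
  have h4 := (measurePreserving_eval hK n).quasiMeasurePreserving.ae_eq_comp
    (hK.coeFn_op G (h := g) (.refl _ _))
  filter_upwards [h4] with ω h4
  simp only [Function.comp] at h4
  rw [h4, ← integral_const_mul]
  rfl

lemma inner_eval_add (hK : DetailedBalance μ K) (F G : Lp ℝ 2 μ) (j k : ℕ) :
    ⟪pullback (measurePreserving_eval hK j) F, pullback (measurePreserving_eval hK (j + k)) G⟫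
      = ⟪F, (hK.op ^ k) G⟫ := by
  induction k generalizing G with
  | zero => exact LinearIsometry.inner_map_map _ F G
  | succ k ih =>
    rw [← add_assoc, inner_eval_succ hK F G (Nat.le_add_right j k), ih, pow_succ]
    rfl

/-- The second moment of the sum of `n` consecutive values of a stationary reversible chain. -/
lemma norm_sum_eval_sq (hK : DetailedBalance μ K) (F : Lp ℝ 2 μ) (n : ℕ) :
    ‖∑ k ∈ Finset.Icc 1 n, pullback (measurePreserving_eval hK k) F‖ ^ 2
      = ∑ j ∈ Finset.range n, covSum (fun k => ⟪F, (hK.op ^ k) F⟫) j := by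
  induction n with
  | zero => simp
  | succ n ih =>
    -- the covariance with the new value depends on the lag `n + 1 - k` only
    have h1 : ∑ k ∈ Finset.Icc 1 n, ⟪pullback (measurePreserving_eval hK k) F,
        pullback (measurePreserving_eval hK (n + 1)) F⟫
          = ∑ k ∈ Finset.range n, ⟪F, (hK.op ^ (k + 1)) F⟫ := by
      refine Finset.sum_nbij' (fun k => n - k) (fun k => n - k) ?_ ?_ ?_ ?_ ?_
      · intro k hk; simp only [Finset.mem_Icc, Finset.mem_range] at *; omega
      · intro k hk; simp only [Finset.mem_Icc, Finset.mem_range] at *; omega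
      · intro k hk; simp only [Finset.mem_Icc] at *; omega
      · intro k hk; simp only [Finset.mem_range] at *; omega
      · intro k hk
        have h2 : n + 1 = k + (n - k + 1) := by simp only [Finset.mem_Icc] at hk; omega
        rw [← inner_eval_add hK F F k]
        congr 3
        funext ω
        rw [← h2]
    rw [Finset.sum_Icc_succ_top (by omega), norm_add_sq_real, ih, Finset.sum_range_succ, sum_inner,
      h1, LinearIsometry.norm_map, covSum, Finset.sum_range_succ']
    simp only [pow_zero, one_apply_eq_self, real_inner_self_eq_norm_sq]
    ring

lemma scaledSumVar_eq (hK : DetailedBalance μ K) {f : E → ℝ} (hf : MemLp f 2 μ) {n : ℕ}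
    (hn : n ≠ 0) : scaledSumVar μ K f n = ENNReal.ofReal ((n⁻¹ : ℝ) * ∑ j ∈ Finset.range n,
      covSum (fun k => ⟪DetailedBalance.centered μ hf,
        (hK.op ^ k) (DetailedBalance.centered μ hf)⟫) j) := by
  set F := DetailedBalance.centered μ hf with hF
  set S := ∑ k ∈ Finset.Icc 1 n, pullback (measurePreserving_eval hK k) F with hS
  have h1 : (S : (ℕ → E) → ℝ) =ᵐ[chainLaw μ K]
      fun ω => ∑ k ∈ Finset.Icc 1 n, (f (ω k) - ∫ x, f x ∂μ) := by
    have h2 : ∀ᵐ ω ∂(chainLaw μ K), ∀ k,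
        (pullback (measurePreserving_eval hK k) F : (ℕ → E) → ℝ) ω = f (ω k) - ∫ x, f x ∂μ := by
      refine ae_all_iff.2 fun k => ?_
      filter_upwards [coeFn_pullback (measurePreserving_eval hK k) F,
        (measurePreserving_eval hK k).quasiMeasurePreserving.ae_eq_comp
          (DetailedBalance.coeFn_centered hf)] with ω h1 h2
      rw [h1]; exact h2
    filter_upwards [h2, Lp.coeFn_fun_finsetSum (Finset.Icc 1 n)
      fun k => pullback (measurePreserving_eval hK k) F] with ω h2 h3
    rw [hS, h3]
    exact Finset.sum_congr rfl fun k _ => h2 k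
  rw [← norm_sum_eval_sq hK, ← hS, ENNReal.ofReal_mul (by positivity),
    ENNReal.ofReal_inv_of_pos (by positivity), ENNReal.ofReal_natCast, mul_comm,
    ← div_eq_mul_inv, ← real_inner_self_eq_norm_sq, L2_inner_eq,
    ofReal_integral_eq_lintegral_ofReal (L2_integrable_mul _ _)
      (.of_forall fun _ => mul_self_nonneg _), scaledSumVar]
  congr 1
  refine lintegral_congr_ae ?_
  filter_upwards [h1] with ω h1
  rw [h1, sq]

/-- The asymptotic variance of a reversible chain exists, and is the limit of the Abel means of the
autocovariance series, expressed by means of the resolvent. -/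
lemma exists_hasAsymptoticVariance (hK : DetailedBalance μ K) {f : E → ℝ} (hf : MemLp f 2 μ) :
    ∃ v : ℝ≥0∞, HasAsymptoticVariance μ K f v ∧
      Tendsto (fun t : ℝ => ENNReal.ofReal (2 * ⟪DetailedBalance.centered μ hf,
        IsSymmContraction.resolvent hK.op t (DetailedBalance.centered μ hf)⟫
          - ‖DetailedBalance.centered μ hf‖ ^ 2)) (𝓝[<] 1) (𝓝 v) := by
  obtain ⟨v, h1, h2⟩ := hK.isSymmContraction_op.exists_limit (DetailedBalance.centered μ hf)
  refine ⟨v, h1.congr' ?_, h2.congr' ?_⟩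
  · filter_upwards [eventually_ne_atTop 0] with n hn using (scaledSumVar_eq hK hf hn).symm
  · filter_upwards [Ico_mem_nhdsLT one_pos] with t ht
    rw [hK.isSymmContraction_op.inner_resolvent _ _ ht]

end Chain

/-! ### Reversibility of Metropolis-Hastings kernels -/

section Reversibility

variable {E X : Type*} [MeasurableSpace E] [MeasurableSpace X]

lemma lintegral_mhKernel (κ : Kernel E E) [IsMarkovKernel κ] {r : E → E → ℝ≥0∞}
    (hr : Measurable (Function.uncurry r)) (x : E) {g : E → ℝ≥0∞} (hg : Measurable g) :
    ∫⁻ y, g y ∂(mhKernel κ r hr x)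
      = ∫⁻ y, min 1 (r x y) * g y ∂(κ x) + (1 - ∫⁻ y, min 1 (r x y) ∂(κ x)) * g x := by
  change ∫⁻ y, g y ∂((κ x).withDensity (fun y => min 1 (r x y)) +
      (1 - ∫⁻ y, min 1 (r x y) ∂(κ x)) • Measure.dirac x) = _
  have h1 : Measurable fun y => min 1 (r x y) :=
    measurable_const.min (hr.comp measurable_prodMk_left)
  rw [lintegral_add_measure, lintegral_smul_measure, lintegral_dirac' x hg,
    lintegral_withDensity_eq_lintegral_mul _ h1 hg]
  rfl

lemma lintegral_compProd_mhKernel {μ : Measure E} [SFinite μ] {κ : Kernel E E} [IsMarkovKernel κ]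
    {r : E → E → ℝ≥0∞} (hr : Measurable (Function.uncurry r)) {g : E × E → ℝ≥0∞}
    (hg : Measurable g) :
    ∫⁻ p, g p ∂(μ ⊗ₘ mhKernel κ r hr) = ∫⁻ p, min 1 (r p.1 p.2) * g p ∂(μ ⊗ₘ κ)
      + ∫⁻ x, (1 - ∫⁻ y, min 1 (r x y) ∂(κ x)) * g (x, x) ∂μ := by
  have h1 : Measurable fun p : E × E => min 1 (r p.1 p.2) * g p := (measurable_min_one hr).mul hg
  rw [Measure.lintegral_compProd hg, Measure.lintegral_compProd h1,
    ← lintegral_add_left h1.lintegral_kernel_prod_right']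
  refine lintegral_congr fun x => ?_
  rw [lintegral_mhKernel κ hr x (g := fun y => g (x, y)) (by fun_prop)]

/-- A Metropolis-Hastings type kernel is reversible as soon as its accepted moves are. -/
lemma detailedBalance_mhKernel {μ : Measure E} [SFinite μ] {κ : Kernel E E} [IsMarkovKernel κ]
    {r : E → E → ℝ≥0∞} (hr : Measurable (Function.uncurry r))
    (h : ∀ g : E × E → ℝ≥0∞, Measurable g → ∫⁻ p, min 1 (r p.1 p.2) * g p.swap ∂(μ ⊗ₘ κ)
      = ∫⁻ p, min 1 (r p.1 p.2) * g p ∂(μ ⊗ₘ κ)) :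
    DetailedBalance μ (mhKernel κ r hr) := by
  refine ⟨measurable_swap, Measure.ext_of_lintegral _ fun g hg => ?_⟩
  rw [lintegral_map hg measurable_swap, lintegral_compProd_mhKernel hr hg,
    lintegral_compProd_mhKernel hr (g := fun p => g p.swap) (by fun_prop), h g hg]
  rfl

/-- With respect to the symmetric measure `m = μ + μ'`, where `μ = π(dx) q(x, dy)` and `μ'` is its
image under the exchange of the coordinates, `μ` has a density `a`, `μ'` has the density
`a(y, x)`, and `r` is the ratio of the two wherever `a` does not vanish. -/
lemma IsMHRatio.exists_density {π : Measure X} [IsFiniteMeasure π] {q : Kernel X X}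
    [IsMarkovKernel q] {r : X → X → ℝ≥0∞} (h : IsMHRatio π q r) :
    ∃ (m : Measure (X × X)) (a : X × X → ℝ≥0∞), MeasurePreserving Prod.swap m m ∧ Measurable a ∧
      π ⊗ₘ q = m.withDensity a ∧ ∀ᵐ p ∂m, a p = 0 ∨ a p * r p.1 p.2 = a p.swap := by
  set μ := π ⊗ₘ q with hμ
  set ν := μ.map Prod.swap with hν
  have : IsFiniteMeasure ν := Measure.isFiniteMeasure_map _ _
  have hνμ : ν.map Prod.swap = μ := by
    rw [hν, Measure.map_map measurable_swap measurable_swap, Prod.swap_swap_eq, Measure.map_id]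
  have hsym : (ν + μ).map Prod.swap = ν + μ := by
    rw [Measure.map_add _ _ measurable_swap, hνμ, ← hν, add_comm]
  have hac : μ ≪ ν + μ := Measure.AbsolutelyContinuous.rfl.add_right' _
  have hdens : (ν + μ).withDensity (μ.rnDeriv (ν + μ)) = μ := Measure.withDensity_rnDeriv_eq _ _ hac
  refine ⟨ν + μ, μ.rnDeriv (ν + μ), ⟨measurable_swap, hsym⟩, Measure.measurable_rnDeriv _ _,
    hdens.symm, ?_⟩
  have hswap : ∀ᵐ p ∂(ν + μ), ν.rnDeriv (ν + μ) p = μ.rnDeriv (ν + μ) p.swap := by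
    have h1 :=
      (MeasurableEquiv.prodComm (α := X) (β := X)).measurableEmbedding.rnDeriv_map ν (ν + μ)
    have h2 : ν.map (MeasurableEquiv.prodComm (α := X) (β := X)) = μ := hνμ
    have h3 : (ν + μ).map (MeasurableEquiv.prodComm (α := X) (β := X)) = ν + μ := hsym
    rw [h2, h3] at h1
    filter_upwards [h1] with p hp using hp.symm
  have hratio : ∀ᵐ p ∂((ν + μ).withDensity (μ.rnDeriv (ν + μ))),
      r p.1 p.2 = ν.rnDeriv (ν + μ) p / μ.rnDeriv (ν + μ) p := by
    rw [hdens]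
    filter_upwards [h, Measure.rnDeriv_eq_div_rnDeriv_add ν μ] with p h1 h2
    exact h1.trans h2
  rw [ae_withDensity_iff (Measure.measurable_rnDeriv _ _)] at hratio
  filter_upwards [hswap, hratio, Measure.rnDeriv_lt_top μ (ν + μ)] with p h1 h2 h3
  by_cases h0 : μ.rnDeriv (ν + μ) p = 0
  · exact .inl h0
  · right
    rw [h2 h0, ENNReal.mul_div_cancel h0 h3.ne, h1]

lemma ennreal_mul_min (a b c : ℝ≥0∞) : a * min b c = min (a * b) (a * c) :=
  Monotone.map_min (f := fun x => a * x) fun _ _ h => mul_le_mul_right h a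

/-- Reversibility of the marginal kernel. -/
lemma IsMHRatio.detailedBalance {π : Measure X} [IsFiniteMeasure π] {q : Kernel X X}
    [IsMarkovKernel q] {r : X → X → ℝ≥0∞} (h : IsMHRatio π q r)
    (hr : Measurable (Function.uncurry r)) : DetailedBalance π (mhKernel q r hr) := by
  obtain ⟨m, a, hm, ha, hπq, hra⟩ := h.exists_density
  refine detailedBalance_mhKernel hr fun g hg => ?_
  -- the accepted moves have density `min (a(x, y)) (a(y, x))`
  have key : ∀ g : X × X → ℝ≥0∞, Measurable g → ∫⁻ p, min 1 (r p.1 p.2) * g p ∂(π ⊗ₘ q)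
      = ∫⁻ p, min (a p) (a p.swap) * g p ∂m := by
    intro g hg
    have h1 : Measurable fun p : X × X => min 1 (r p.1 p.2) * g p := (measurable_min_one hr).mul hg
    rw [hπq, lintegral_withDensity_eq_lintegral_mul _ ha h1]
    refine lintegral_congr_ae ?_
    filter_upwards [hra] with p hp
    rw [Pi.mul_apply, ← mul_assoc, ennreal_mul_min, mul_one]
    rcases hp with hp | hp
    · simp [hp]
    · rw [hp]
  rw [key (fun p => g p.swap) (by fun_prop), key g hg,
    ← hm.lintegral_comp (f := fun p => min (a p) (a p.swap) * g p)
      ((ha.min (ha.comp measurable_swap)).mul hg)]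
  refine lintegral_congr fun p => ?_
  rw [Prod.swap_swap, min_comm]

end Reversibility

/-! ### The pseudo-marginal kernel and the functionals `Δ_P̄` and `Δ_P̃` -/

section PseudoMarginalChain

variable {X : Type*} [MeasurableSpace X] {W : Set ℝ≥0}

/-- The law `Q_x(dw) Q_y(du)` of two independent weights, as a kernel in `(x, y)`. -/
def pairKernel (Q : Kernel X W) : Kernel (X × X) (W × W) :=
  Q.comap Prod.fst measurable_fst ×ₖ Q.comap Prod.snd measurable_snd

instance (Q : Kernel X W) [IsMarkovKernel Q] : IsMarkovKernel (pairKernel Q) := by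
  unfold pairKernel; infer_instance

lemma pairKernel_apply (Q : Kernel X W) [IsMarkovKernel Q] (p : X × X) :
    pairKernel Q p = (Q p.1).prod (Q p.2) := by
  rw [pairKernel, Kernel.prod_apply, Kernel.comap_apply, Kernel.comap_apply]

lemma lintegral_weightKernel (Q : Kernel X W) [IsMarkovKernel Q] (x : X) {g : W → ℝ≥0∞}
    (hg : Measurable g) : ∫⁻ w, g w ∂(weightKernel Q x) = ∫⁻ w, ((w : ℝ≥0) : ℝ≥0∞) * g w ∂(Q x) :=
  Kernel.lintegral_withDensity Q (by fun_prop) x hg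

lemma isMarkovKernel_weightKernel {Q : Kernel X W} [IsMarkovKernel Q]
    (hQ : ∀ x, ∫⁻ w, ((w : ℝ≥0) : ℝ≥0∞) ∂(Q x) = 1) : IsMarkovKernel (weightKernel Q) :=
  ⟨fun x => ⟨by simpa [hQ x] using lintegral_weightKernel Q x measurable_one⟩⟩

lemma measurePreserving_fst_pseudoTarget (π : Measure X) [IsProbabilityMeasure π] {Q : Kernel X W}
    [IsMarkovKernel Q] (hQ : ∀ x, ∫⁻ w, ((w : ℝ≥0) : ℝ≥0∞) ∂(Q x) = 1) :
    MeasurePreserving Prod.fst (pseudoTarget π Q) π :=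
  have := isMarkovKernel_weightKernel hQ
  ⟨measurable_fst, Measure.fst_compProd π _⟩

lemma isProbabilityMeasure_pseudoTarget (π : Measure X) [IsProbabilityMeasure π] {Q : Kernel X W}
    [IsMarkovKernel Q] (hQ : ∀ x, ∫⁻ w, ((w : ℝ≥0) : ℝ≥0∞) ∂(Q x) = 1) :
    IsProbabilityMeasure (pseudoTarget π Q) := by
  have := isMarkovKernel_weightKernel hQ
  unfold pseudoTarget
  infer_instance

/-- The conventions for `u / 0` in `[0, ∞]` do no harm, because of the factor `w` which comes from
the target. -/
lemma weight_mul_min (w u : ℝ≥0) (s : ℝ≥0∞) :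
    (w : ℝ≥0∞) * min 1 (s * ((u : ℝ≥0∞) / (w : ℝ≥0∞))) = min (w : ℝ≥0∞) (s * u) := by
  by_cases hw : w = 0
  · simp [hw]
  · rw [ennreal_mul_min, mul_one, mul_left_comm,
      ENNReal.mul_div_cancel (by simpa using hw) ENNReal.coe_ne_top]

lemma lintegral_pseudoProposal (q : Kernel X X) [IsMarkovKernel q] (Q : Kernel X W)
    [IsMarkovKernel Q] (z : X × W) {g : X × W → ℝ≥0∞} (hg : Measurable g) :
    ∫⁻ z', g z' ∂(pseudoProposal q Q z) = ∫⁻ y, ∫⁻ u, g (y, u) ∂(Q y) ∂(q z.1) := by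
  rw [pseudoProposal, Kernel.prodMkRight_apply, Kernel.lintegral_compProd _ _ _ hg]
  simp

/-- The law of the current state of the pseudo-marginal chain and its proposal: a pair `(x, y)` with
law `π(dx) q(x, dy)`, independent weights, and the density given by the first weight. -/
lemma lintegral_pseudoTarget_pseudoProposal (π : Measure X) [IsProbabilityMeasure π]
    (q : Kernel X X) [IsMarkovKernel q] {Q : Kernel X W} [IsMarkovKernel Q]
    (hQ : ∀ x, ∫⁻ w, ((w : ℝ≥0) : ℝ≥0∞) ∂(Q x) = 1) {g : (X × W) × (X × W) → ℝ≥0∞}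
    (hg : Measurable g) :
    ∫⁻ p, g p ∂(pseudoTarget π Q ⊗ₘ pseudoProposal q Q)
      = ∫⁻ p, ∫⁻ s, ((s.1 : ℝ≥0) : ℝ≥0∞) * g ((p.1, s.1), (p.2, s.2)) ∂(pairKernel Q p)
        ∂(π ⊗ₘ q) := by
  have := isMarkovKernel_weightKernel hQ
  have := isProbabilityMeasure_pseudoTarget π hQ
  have h1 : Measurable fun p : X × X =>
      ∫⁻ s, ((s.1 : ℝ≥0) : ℝ≥0∞) * g ((p.1, s.1), (p.2, s.2)) ∂(pairKernel Q p) :=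
    Measurable.lintegral_kernel_prod_right' (κ := pairKernel Q)
      (f := fun v : (X × X) × (W × W) =>
        ((v.2.1 : ℝ≥0) : ℝ≥0∞) * g ((v.1.1, v.2.1), (v.1.2, v.2.2))) (by fun_prop)
  rw [Measure.lintegral_compProd hg, Measure.lintegral_compProd h1]
  have h2 : Measurable fun z : X × W => ∫⁻ z', g (z, z') ∂(pseudoProposal q Q z) :=
    hg.lintegral_kernel_prod_right'
  rw [pseudoTarget, Measure.lintegral_compProd h2]
  refine lintegral_congr fun x => ?_
  rw [lintegral_weightKernel Q x
    (g := fun w => ∫⁻ z', g ((x, w), z') ∂(pseudoProposal q Q (x, w)))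
    (h2.comp measurable_prodMk_left)]
  have h3 : ∀ w : W, ((w : ℝ≥0) : ℝ≥0∞) * ∫⁻ z', g ((x, w), z') ∂(pseudoProposal q Q (x, w))
      = ∫⁻ y, ∫⁻ u, ((w : ℝ≥0) : ℝ≥0∞) * g ((x, w), (y, u)) ∂(Q y) ∂(q x) := by
    intro w
    rw [lintegral_pseudoProposal q Q (x, w) (g := fun z' => g ((x, w), z')) (by fun_prop),
      ← lintegral_const_mul]
    · refine lintegral_congr fun y => ?_
      rw [lintegral_const_mul]
      exact hg.comp (by fun_prop)
    · exact Measurable.lintegral_kernel_prod_right' (κ := Q)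
        (f := fun v : X × W => g ((x, w), v)) (hg.comp measurable_prodMk_left)
  simp_rw [h3]
  rw [lintegral_lintegral_swap]
  · refine lintegral_congr fun y => ?_
    rw [pairKernel_apply, lintegral_prod _ (by fun_prop)]
  · exact (Measurable.lintegral_kernel_prod_right'
      (κ := Q.comap (Prod.snd : W × X → X) measurable_snd)
      (f := fun v : (W × X) × W => ((v.1.1 : ℝ≥0) : ℝ≥0∞) * g ((x, v.1.1), (v.1.2, v.2)))
      (by fun_prop)).aemeasurable

/-- Reversibility of the pseudo-marginal kernel. -/
lemma IsMHRatio.detailedBalance_pseudoKernel {π : Measure X} [IsProbabilityMeasure π]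
    {q : Kernel X X} [IsMarkovKernel q] {r : X → X → ℝ≥0∞} (h : IsMHRatio π q r)
    (hr : Measurable (Function.uncurry r)) {Q : Kernel X W} [IsMarkovKernel Q]
    (hQ : ∀ x, ∫⁻ w, ((w : ℝ≥0) : ℝ≥0∞) ∂(Q x) = 1) :
    DetailedBalance (pseudoTarget π Q) (pseudoKernel q Q r hr) := by
  have := isProbabilityMeasure_pseudoTarget π hQ
  obtain ⟨m, a, hm, ha, hπq, hra⟩ := h.exists_density
  refine detailedBalance_mhKernel (measurable_pseudoRatio hr) fun g hg => ?_
  -- the density of the accepted moves, symmetric under exchange of `(x, w)` and `(y, u)`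
  let D : (X × X) × (W × W) → ℝ≥0∞ := fun v =>
    min (a v.1 * ((v.2.1 : ℝ≥0) : ℝ≥0∞)) (a v.1.swap * ((v.2.2 : ℝ≥0) : ℝ≥0∞))
  have hD : Measurable D := by
    have : Measurable fun v : (X × X) × (W × W) => a v.1.swap := ha.comp (by fun_prop)
    fun_prop
  have key : ∀ g : (X × W) × (X × W) → ℝ≥0∞, Measurable g →
      ∫⁻ p, min 1 (pseudoRatio r p.1 p.2) * g p ∂(pseudoTarget π Q ⊗ₘ pseudoProposal q Q)
      = ∫⁻ p, ∫⁻ s, D (p, s) * g ((p.1, s.1), (p.2, s.2)) ∂(pairKernel Q p) ∂m := by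
    intro g hg
    have h1 : Measurable fun p : (X × W) × (X × W) => min 1 (pseudoRatio r p.1 p.2) * g p :=
      (measurable_min_one (measurable_pseudoRatio hr)).mul hg
    have h2 : Measurable fun v : (X × X) × (W × W) =>
        ((v.2.1 : ℝ≥0) : ℝ≥0∞) * (min 1 (pseudoRatio r (v.1.1, v.2.1) (v.1.2, v.2.2)) *
          g ((v.1.1, v.2.1), (v.1.2, v.2.2))) :=
      Measurable.mul (by fun_prop) (h1.comp
        (g := fun p : (X × W) × (X × W) => min 1 (pseudoRatio r p.1 p.2) * g p)
        (f := fun v : (X × X) × (W × W) => ((v.1.1, v.2.1), (v.1.2, v.2.2))) (by fun_prop))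
    rw [lintegral_pseudoTarget_pseudoProposal π q hQ h1, hπq,
      lintegral_withDensity_eq_lintegral_mul _ ha
        (Measurable.lintegral_kernel_prod_right' (κ := pairKernel Q) h2)]
    refine lintegral_congr_ae ?_
    filter_upwards [hra] with p hp
    rw [Pi.mul_apply]
    refine (lintegral_const_mul _ (h2.comp measurable_prodMk_left)).symm.trans ?_
    refine lintegral_congr fun s => ?_
    simp only [Function.comp, pseudoRatio, D, ← mul_assoc]
    congr 1
    rw [mul_assoc, weight_mul_min, ennreal_mul_min]
    rcases hp with hp | hp
    · simp [hp]
    · rw [← mul_assoc, hp]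
  have h3 : Measurable fun v : (X × X) × (W × W) => D v * g ((v.1.1, v.2.1), (v.1.2, v.2.2)) := by
    fun_prop
  rw [key (fun p => g p.swap) (by fun_prop), key g hg,
    ← hm.lintegral_comp (Measurable.lintegral_kernel_prod_right' (κ := pairKernel Q) h3)]
  refine lintegral_congr fun p => ?_
  rw [pairKernel_apply, pairKernel_apply, Prod.fst_swap, Prod.snd_swap, ← Measure.prod_swap,
    lintegral_map (f := fun s : W × W => D (p, s) * g ((p.1, s.1), (p.2, s.2)).swap)
      (by fun_prop) measurable_swap]
  refine lintegral_congr fun s => ?_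
  simp only [D, Prod.swap_swap, Prod.fst_swap, Prod.snd_swap, Prod.swap_prod_mk]
  rw [min_comm]

/-- The weights integrate out of `Δ_P̄(g)`, which is the integral of `g` over the accepted moves of
the marginal chain. -/
lemma deltaBar_eq (π : Measure X) [IsProbabilityMeasure π] (q : Kernel X X) [IsMarkovKernel q]
    {Q : Kernel X W} [IsMarkovKernel Q] (hQ : ∀ x, ∫⁻ w, ((w : ℝ≥0) : ℝ≥0∞) ∂(Q x) = 1)
    {r : X → X → ℝ≥0∞} (hr : Measurable (Function.uncurry r)) {g : X → X → ℝ≥0∞}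
    (hg : Measurable (Function.uncurry g)) :
    deltaBar π q Q r g = ∫⁻ p, min 1 (r p.1 p.2) * g p.1 p.2 ∂(π ⊗ₘ q) := by
  have := isMarkovKernel_weightKernel hQ
  have h1 : Measurable fun p : X × X => min 1 (r p.1 p.2) * g p.1 p.2 :=
    (measurable_min_one hr).mul hg
  simp only [deltaBar, lintegral_const, measure_univ, mul_one]
  rw [(measurePreserving_fst_pseudoTarget π hQ).lintegral_comp
    (f := fun x => ∫⁻ y, min 1 (r x y) * g x y ∂(q x)) h1.lintegral_kernel_prod_right',
    Measure.lintegral_compProd h1]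

/-- `Δ_P̃(g)` is the integral of `g` over the accepted moves of the pseudo-marginal chain. -/
lemma deltaTilde_eq (π : Measure X) [IsProbabilityMeasure π] (q : Kernel X X) [IsMarkovKernel q]
    {Q : Kernel X W} [IsMarkovKernel Q] (hQ : ∀ x, ∫⁻ w, ((w : ℝ≥0) : ℝ≥0∞) ∂(Q x) = 1)
    {r : X → X → ℝ≥0∞} (hr : Measurable (Function.uncurry r)) {g : X → X → ℝ≥0∞}
    (hg : Measurable (Function.uncurry g)) :
    deltaTilde π q Q r g = ∫⁻ p, min 1 (pseudoRatio r p.1 p.2) * g p.1.1 p.2.1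
      ∂(pseudoTarget π Q ⊗ₘ pseudoProposal q Q) := by
  have := isProbabilityMeasure_pseudoTarget π hQ
  have h1 : Measurable fun p : (X × W) × (X × W) =>
      min 1 (pseudoRatio r p.1 p.2) * g p.1.1 p.2.1 :=
    (measurable_min_one (measurable_pseudoRatio hr)).mul
      (hg.comp (f := fun p : (X × W) × (X × W) => (p.1.1, p.2.1)) (by fun_prop))
  rw [Measure.lintegral_compProd h1, deltaTilde]
  refine lintegral_congr fun z => ?_
  exact (lintegral_pseudoProposal q Q z (h1.comp measurable_prodMk_left)).symm

/-- By concavity of the minimum, replacing the weights by their means `1` does not decrease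
the acceptance probability. -/
lemma deltaTilde_le_deltaBar (π : Measure X) [IsProbabilityMeasure π] (q : Kernel X X)
    [IsMarkovKernel q] {Q : Kernel X W} [IsMarkovKernel Q]
    (hQ : ∀ x, ∫⁻ w, ((w : ℝ≥0) : ℝ≥0∞) ∂(Q x) = 1)
    {r : X → X → ℝ≥0∞} (hr : Measurable (Function.uncurry r)) {g : X → X → ℝ≥0∞}
    (hg : Measurable (Function.uncurry g)) : deltaTilde π q Q r g ≤ deltaBar π q Q r g := by
  have h1 : Measurable fun p : (X × W) × (X × W) =>
      min 1 (pseudoRatio r p.1 p.2) * g p.1.1 p.2.1 :=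
    (measurable_min_one (measurable_pseudoRatio hr)).mul
      (hg.comp (f := fun p : (X × W) × (X × W) => (p.1.1, p.2.1)) (by fun_prop))
  rw [deltaTilde_eq π q hQ hr hg, deltaBar_eq π q hQ hr hg,
    lintegral_pseudoTarget_pseudoProposal π q hQ h1]
  refine lintegral_mono fun p => ?_
  simp only [pseudoRatio, ← mul_assoc, weight_mul_min]
  rw [lintegral_mul_const _ (by fun_prop)]
  gcongr
  have h2 : ∫⁻ s, ((s.1 : ℝ≥0) : ℝ≥0∞) ∂(pairKernel Q p) = 1 := by
    rw [pairKernel_apply, lintegral_prod _ (by fun_prop)]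
    simp [hQ]
  have h3 : ∫⁻ s, ((s.2 : ℝ≥0) : ℝ≥0∞) ∂(pairKernel Q p) = 1 := by
    rw [pairKernel_apply, lintegral_prod _ (by fun_prop)]
    simp [hQ]
  refine le_min ?_ ?_
  · rw [← h2]
    exact lintegral_mono fun s => min_le_left _ _
  · calc ∫⁻ s, min ((s.1 : ℝ≥0) : ℝ≥0∞) (r p.1 p.2 * ((s.2 : ℝ≥0) : ℝ≥0∞)) ∂(pairKernel Q p)
        ≤ ∫⁻ s, r p.1 p.2 * ((s.2 : ℝ≥0) : ℝ≥0∞) ∂(pairKernel Q p) :=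
          lintegral_mono fun s => min_le_right _ _
      _ = r p.1 p.2 := by rw [lintegral_const_mul _ (by fun_prop), h3, mul_one]

end PseudoMarginalChain

/-! ### Comparison of the two chains -/

section Comparison

/-- The mean square increment of a function over the accepted moves, as a Dirichlet form. Rejected
moves do not contribute, since the increment vanishes on the diagonal. -/
lemma lintegral_accept_sq_sub {E : Type*} [MeasurableSpace E] {μ : Measure E}
    [IsProbabilityMeasure μ] {κ : Kernel E E} [IsMarkovKernel κ] {r : E → E → ℝ≥0∞}
    {hr : Measurable (Function.uncurry r)} (hK : DetailedBalance μ (mhKernel κ r hr))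
    (F : Lp ℝ 2 μ) {h : E → ℝ} (hh : Measurable h) (hF : F =ᵐ[μ] h) :
    ∫⁻ p, min 1 (r p.1 p.2) * ENNReal.ofReal ((h p.1 - h p.2) ^ 2) ∂(μ ⊗ₘ κ)
      = ENNReal.ofReal (2 * (‖F‖ ^ 2 - ⟪F, hK.op F⟫)) := by
  have h1 := lintegral_compProd_mhKernel (μ := μ) (κ := κ) hr
    (g := fun p => ENNReal.ofReal ((h p.1 - h p.2) ^ 2)) (by fun_prop)
  simp only [sub_self, ne_eq, OfNat.ofNat_ne_zero, not_false_eq_true, zero_pow, ENNReal.ofReal_zero,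
    mul_zero, lintegral_zero, add_zero] at h1
  rw [← h1, ← hK.lintegral_sq_sub]
  refine lintegral_congr_ae ?_
  filter_upwards [(measurePreserving_fst_compProd (μ := μ)
      (K := mhKernel κ r hr)).quasiMeasurePreserving.ae_eq_comp hF,
    hK.measurePreserving_snd.quasiMeasurePreserving.ae_eq_comp hF] with p h2 h3
  simp only [Function.comp] at h2 h3
  rw [h2, h3]

variable {X : Type*} [MeasurableSpace X] {W : Set ℝ≥0} {π : Measure X} [IsProbabilityMeasure π]

lemma pullback_centered {Q : Kernel X W} [IsMarkovKernel Q]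
    [IsProbabilityMeasure (pseudoTarget π Q)]
    (hfst : MeasurePreserving Prod.fst (pseudoTarget π Q) π) {f : X → ℝ} (hf : MemLp f 2 π)
    (hft : MemLp (fun z : X × W => f z.1) 2 (pseudoTarget π Q)) :
    pullback hfst (DetailedBalance.centered π hf)
      = DetailedBalance.centered (pseudoTarget π Q) hft := by
  have h1 : ∫ z, f z.1 ∂(pseudoTarget π Q) = ∫ x, f x ∂π := by
    have h2 := integral_map hfst.measurable.aemeasurable
      (f := f) (by rw [hfst.map_eq]; exact hf.aestronglyMeasurable)
    rw [hfst.map_eq] at h2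
    exact h2.symm
  refine Lp.ext ?_
  filter_upwards [coeFn_pullback hfst (DetailedBalance.centered π hf),
    hfst.quasiMeasurePreserving.ae_eq_comp (DetailedBalance.coeFn_centered hf),
    DetailedBalance.coeFn_centered hft] with z h2 h3 h4
  rw [h2, h4, h1]
  exact h3

/-- If `a t → v` and `b t → w` in `[0, ∞]` and `a t + t d t ≤ b t` with `d ≥ 0`, then `v` plus the
lower limit of `d` at `1` is at most `w`. -/
lemma add_liminf_le {a b d : ℝ → ℝ} {v w : ℝ≥0∞}
    (ha : Tendsto (fun t => ENNReal.ofReal (a t)) (𝓝[<] 1) (𝓝 v))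
    (hb : Tendsto (fun t => ENNReal.ofReal (b t)) (𝓝[<] 1) (𝓝 w))
    (h : ∀ t ∈ Set.Ico (0 : ℝ) 1, 0 ≤ a t ∧ 0 ≤ d t ∧ a t + t * d t ≤ b t) :
    (v : EReal) + liminf (fun t => (d t : EReal)) (𝓝[<] 1) ≤ (w : EReal) := by
  have h_ev : ∀ᶠ t : ℝ in 𝓝[<] 1, t ∈ Set.Ico (0 : ℝ) 1 := Ico_mem_nhdsLT one_pos
  have hvw : v ≤ w := by
    refine le_of_tendsto_of_tendsto ha hb ?_
    filter_upwards [h_ev] with t ht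
    obtain ⟨h1, h2, h3⟩ := h t ht
    exact ENNReal.ofReal_le_ofReal (by nlinarith [mul_nonneg ht.1 h2])
  rcases eq_or_ne w ∞ with rfl | hw
  · simp
  have hv : v ≠ ∞ := ne_top_of_le_ne_top hw hvw
  lift v to ℝ≥0 using hv
  lift w to ℝ≥0 using hw
  have key : liminf (fun t => (d t : EReal)) (𝓝[<] 1) ≤ ((w - v : ℝ) : EReal) := by
    refine EReal.ge_of_forall_gt_iff_ge.1 fun y hy => EReal.coe_le_coe_iff.2 ?_
    have ha' : Tendsto a (𝓝[<] 1) (𝓝 v) := by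
      refine ((ENNReal.tendsto_toReal ENNReal.coe_ne_top).comp ha).congr' ?_
      filter_upwards [h_ev] with t ht using ENNReal.toReal_ofReal (h t ht).1
    have hb' : Tendsto b (𝓝[<] 1) (𝓝 w) := by
      refine ((ENNReal.tendsto_toReal ENNReal.coe_ne_top).comp hb).congr' ?_
      filter_upwards [h_ev] with t ht
      obtain ⟨h1, h2, h3⟩ := h t ht
      exact ENNReal.toReal_ofReal (by nlinarith [mul_nonneg ht.1 h2])
    have hty : Tendsto (fun t : ℝ => t * y) (𝓝[<] 1) (𝓝 (1 * y)) :=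
      (tendsto_id.mono_left nhdsWithin_le_nhds).mul_const y
    rw [le_sub_iff_add_le', ← one_mul y]
    refine le_of_tendsto_of_tendsto (ha'.add hty) hb' ?_
    filter_upwards [h_ev, eventually_lt_of_lt_liminf hy] with t ht hyt
    have h4 : t * y ≤ t * d t := mul_le_mul_of_nonneg_left (EReal.coe_lt_coe_iff.1 hyt).le ht.1
    linarith [(h t ht).2.2]
  calc ((v : ℝ≥0∞) : EReal) + liminf (fun t => (d t : EReal)) (𝓝[<] 1)
      ≤ ((v : ℝ≥0∞) : EReal) + ((w - v : ℝ) : EReal) := by gcongr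
    _ = ((w : ℝ≥0∞) : EReal) := by
      change ((v : ℝ) : EReal) + ((w - v : ℝ) : EReal) = ((w : ℝ) : EReal)
      rw [← EReal.coe_add]
      simp

end Comparison

end PseudoMarginal

end

theorem mainTheorem1 {X : Type*} [MeasurableSpace X]
    (π : Measure X) [IsProbabilityMeasure π]
    (q : Kernel X X) [IsMarkovKernel q]
    (r : X → X → ℝ≥0∞) (hr : Measurable (Function.uncurry r))
    (hπq : PseudoMarginal.IsMHRatio π q r)
    (W : Set ℝ≥0) (hW : MeasurableSet W)
    (Q : Kernel X W) [IsMarkovKernel Q]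
    (hQ : ∀ x, ∫⁻ w, ((w : ℝ≥0) : ℝ≥0∞) ∂(Q x) = 1)
    (f : X → ℝ) (hf : Measurable f) (hf2 : Integrable (fun x => f x ^ 2) π) :
    ∃ v vt : ℝ≥0∞,
      PseudoMarginal.HasAsymptoticVariance π (PseudoMarginal.mhKernel q r hr) f v ∧
      PseudoMarginal.HasAsymptoticVariance (PseudoMarginal.pseudoTarget π Q)
        (PseudoMarginal.pseudoKernel q Q r hr) (fun z => f z.1) vt ∧
      v ≤ vt ∧
      (∀ᵐ x ∂π, ∀ k, Integrable (PseudoMarginal.kernelIter (PseudoMarginal.mhKernel q r hr) f k)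
        (PseudoMarginal.mhKernel q r hr x)) ∧
      (∀ t ∈ Set.Ico (0 : ℝ) 1,
        (∀ᵐ x ∂π, Summable fun k : ℕ =>
          t ^ k * (PseudoMarginal.kernelIter (PseudoMarginal.mhKernel q r hr) f k x
            - ∫ y, f y ∂π)) ∧
        PseudoMarginal.deltaBar π q Q r
          (PseudoMarginal.gFun π (PseudoMarginal.mhKernel q r hr) f t) < ∞ ∧
        PseudoMarginal.deltaTilde π q Q r
          (PseudoMarginal.gFun π (PseudoMarginal.mhKernel q r hr) f t) < ∞) ∧
      (v : EReal) + liminf (fun t : ℝ =>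
          (PseudoMarginal.deltaBar π q Q r
              (PseudoMarginal.gFun π (PseudoMarginal.mhKernel q r hr) f t) : EReal) -
            (PseudoMarginal.deltaTilde π q Q r
              (PseudoMarginal.gFun π (PseudoMarginal.mhKernel q r hr) f t) : EReal)) (𝓝[<] 1)
        ≤ (vt : EReal) := by
  have := PseudoMarginal.isProbabilityMeasure_pseudoTarget π hQ
  have hK := hπq.detailedBalance hr
  have hKt := hπq.detailedBalance_pseudoKernel hr hQ
  have hfst := PseudoMarginal.measurePreserving_fst_pseudoTarget π hQ
  have hfL : MemLp f 2 π := (memLp_two_iff_integrable_sq hf.aestronglyMeasurable).2 hf2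
  have hfLt : MemLp (fun z : X × W => f z.1) 2 (PseudoMarginal.pseudoTarget π Q) :=
    hfL.comp_measurePreserving hfst
  obtain ⟨v, hv, hvA⟩ := PseudoMarginal.exists_hasAsymptoticVariance hK hfL
  obtain ⟨vt, hvt, hvtA⟩ := PseudoMarginal.exists_hasAsymptoticVariance hKt hfLt
  rw [← PseudoMarginal.pullback_centered hfst hfL hfLt] at hvtA
  set F := PseudoMarginal.DetailedBalance.centered π hfL with hF
  set J := PseudoMarginal.pullback hfst with hJ
  let φ : ℝ → Lp ℝ 2 π := fun t => PseudoMarginal.IsSymmContraction.resolvent hK.op t F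
  -- the Dirichlet forms, which are real versions of `Δ_P̄(g_t)` and `Δ_P̃(g_t)`
  let dBar : ℝ → ℝ := fun t => 2 * (‖φ t‖ ^ 2 - inner ℝ (φ t) (hK.op (φ t)))
  let dTilde : ℝ → ℝ := fun t => 2 * (‖J (φ t)‖ ^ 2 - inner ℝ (J (φ t)) (hKt.op (J (φ t))))
  have hg : ∀ t, Measurable (Function.uncurry
      (PseudoMarginal.gFun π (PseudoMarginal.mhKernel q r hr) f t)) := by
    intro t
    have := PseudoMarginal.measurable_phi π (PseudoMarginal.mhKernel q r hr) hf t
    unfold PseudoMarginal.gFun Function.uncurry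
    fun_prop
  have hbar : ∀ t ∈ Set.Ico (0 : ℝ) 1, PseudoMarginal.deltaBar π q Q r
      (PseudoMarginal.gFun π (PseudoMarginal.mhKernel q r hr) f t) = ENNReal.ofReal (dBar t) := by
    intro t ht
    rw [PseudoMarginal.deltaBar_eq π q hQ hr (hg t)]
    exact PseudoMarginal.lintegral_accept_sq_sub hK (φ t)
      (PseudoMarginal.measurable_phi π _ hf t) (hK.ae_phi_eq hfL ht)
  have htilde : ∀ t ∈ Set.Ico (0 : ℝ) 1, PseudoMarginal.deltaTilde π q Q r
      (PseudoMarginal.gFun π (PseudoMarginal.mhKernel q r hr) f t)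
        = ENNReal.ofReal (dTilde t) := by
    intro t ht
    rw [PseudoMarginal.deltaTilde_eq π q hQ hr (hg t)]
    exact PseudoMarginal.lintegral_accept_sq_sub hKt (J (φ t))
      ((PseudoMarginal.measurable_phi π _ hf t).comp measurable_fst)
      ((PseudoMarginal.coeFn_pullback hfst (φ t)).trans
        (hfst.quasiMeasurePreserving.ae_eq_comp (hK.ae_phi_eq hfL ht)))
  have hTilde0 : ∀ t, 0 ≤ dTilde t := fun t => by
    have := (abs_le.1 (hKt.isSymmContraction_op.abs_inner_le (J (φ t)))).2
    simp only [dTilde]; linarith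
  have hBar0 : ∀ t, 0 ≤ dBar t := fun t => by
    have := (abs_le.1 (hK.isSymmContraction_op.abs_inner_le (φ t))).2
    simp only [dBar]; linarith
  have hle : ∀ t ∈ Set.Ico (0 : ℝ) 1, dTilde t ≤ dBar t := by
    intro t ht
    have h1 := PseudoMarginal.deltaTilde_le_deltaBar π q hQ hr (hg t)
    rw [hbar t ht, htilde t ht] at h1
    exact (ENNReal.ofReal_le_ofReal_iff (hBar0 t)).1 h1
  have hmain : (v : EReal) + liminf (fun t : ℝ => ((dBar t - dTilde t : ℝ) : EReal)) (𝓝[<] 1)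
      ≤ (vt : EReal) := by
    refine PseudoMarginal.add_liminf_le hvA hvtA fun t ht =>
      ⟨hK.isSymmContraction_op.abel_nonneg F ht, sub_nonneg.2 (hle t ht), ?_⟩
    have h1 := hK.isSymmContraction_op.inner_resolvent_comparison hKt.isSymmContraction_op J F ht
    simp only [dBar, dTilde, φ, J.norm_map] at *
    linarith
  have hliminf : liminf (fun t : ℝ =>
      (PseudoMarginal.deltaBar π q Q r
          (PseudoMarginal.gFun π (PseudoMarginal.mhKernel q r hr) f t) : EReal) -
        (PseudoMarginal.deltaTilde π q Q r
          (PseudoMarginal.gFun π (PseudoMarginal.mhKernel q r hr) f t) : EReal)) (𝓝[<] 1)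
      = liminf (fun t : ℝ => ((dBar t - dTilde t : ℝ) : EReal)) (𝓝[<] 1) := by
    refine liminf_congr ?_
    filter_upwards [Ico_mem_nhdsLT one_pos] with t ht
    rw [hbar t ht, htilde t ht, EReal.coe_ennreal_ofReal, EReal.coe_ennreal_ofReal,
      max_eq_left (hBar0 t), max_eq_left (hTilde0 t), EReal.coe_sub]
  refine ⟨v, vt, hv, hvt, ?_, ?_, fun t ht => ⟨?_, ?_, ?_⟩, hliminf ▸ hmain⟩
  · have h0 : 0 ≤ liminf (fun t : ℝ => ((dBar t - dTilde t : ℝ) : EReal)) (𝓝[<] 1) := by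
      refine le_liminf_of_le (by isBoundedDefault) ?_
      filter_upwards [Ico_mem_nhdsLT one_pos] with t ht
      exact EReal.coe_nonneg.2 (sub_nonneg.2 (hle t ht))
    exact EReal.coe_ennreal_le_coe_ennreal_iff.1 ((le_add_of_nonneg_right h0).trans hmain)
  · exact ae_all_iff.2 fun k => hK.ae_integrable (hK.integrable_kernelIter hfL k)
  · filter_upwards [hK.ae_hasSum_phi hfL ht] with x hx using hx.summable
  · rw [hbar t ht]; exact ENNReal.ofReal_lt_top
  · rw [htilde t ht]; exact ENNReal.ofReal_lt_top
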